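/- **Setting.** Let $K\ge 1$, $E_k\in\mathbb R^{m\times n_k}$, $A_k\in\mathbb R^{p_k\times n_k}$ ($k=1,\dots,K$), $q\in\mathbb R^m$, $X_k\subset\mathbb R^{n_k}$, $X=X_1\times\dots\times X_K$, $Ex=\sum_kE_kx_k$, and let $f(x)=\sum_k f_k(x_k)$ be extended real valued. All norms are Euclidean. Consider $\min\{f(x): Ex=q,\ x\in X\}$. Put $q_k=0$ for $k<K$ and $q_K=q$; $W=\{w\in(\mathbb R^m)^K:\sum_kw_k=0\}$; $P_{W^\perp}$ the orthogonal projection of $(\mathbb R^m)^K$ onto $W^\perp$; $S=\{(\eta,\zeta):P_{W^\perp}(\eta)=\zeta\}$. Let $$\bar L(w,x,\eta,\zeta)=\sum_{k}\big[f_k(x_k)+\langle\eta_k,E_kx_k-q_k\rangle-\langle\eta_k,w_k\rangle\big]\quad\text{for }(w,x)\in W\times X,\ (\eta,\zeta)\in S,$$ $\bar L=-\infty$ if $(w,x)\in W\times X$, $(\eta,\zeta)\notin S$, and $\bar L=+\infty$ if $(w,x)\notin W\times X$. For $v=(v_1,v_2,v_3,v_4)\in(\mathbb R^m)^K\times\mathbb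 R^n\times(\mathbb R^m)^K\times(\mathbb R^m)^K$, with $n=\sum_kn_k$, let $T_{\bar L}^{-1}(v)$ be the set of $(w,x,\eta,\zeta)$, with $(w,x)\in W\times X$ and $(\eta,\zeta)\in S$, that are saddle points (minimum over $W\times X$, maximum over $S$) of $\bar L(w,x,\eta,\zeta)-\langle w,v_1\rangle-\langle x,v_2\rangle+\langle\eta,v_3\rangle+\langle\zeta,v_4\rangle$. **Assumption 1.** The minimum of $f$ over $\{x\in X:Ex=q\}$ is attained, and either $\operatorname{int}X\cap\operatorname{dom}f\cap\{Ex=q\}\ne\emptyset$, or $X$ is polyhedral and $X\cap\operatorname{int}(\operatorname{dom}f)\cap\{Ex=q\}\neq\emptyset$. **Assumption 2.** $f_k(x_k)=g_k(A_kx_k)+h_k(x_k)$ with $g_k,h_k$ closed proper convex; $g_k$ is strongly convex with modulus $\sigma_k>0$ and continuously differentiable on $\operatorname{int}(\operatorname{dom}g_k)$, with $A_kX_k\subset\operatorname{int}(\operatorname{dom}g_k)$ and $\|A_k^T\nabla g_k(A_kx)-A_k^T\nabla g_k(A_kx')\|\le L_k\|A_k(x-x')\|$ for all $x,x'\in X_k$,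 where $L_k\ge0$; the epigraph of each $h_k$ is a polyhedral convex set; each $X_k$ is a polyhedral convex set and compact. **Inequality form.** For matrices $C_x^k\in\mathbb R^{j_k\times n_k}$ and vectors $C_s^k,c_k\in\mathbb R^{j_k}$, say that $(C_x,C_s,c)$ represents the problem if, for every $k$, $\{(x_k,s_k):x_k\in X_k,\ h_k(x_k)\le s_k\}=\{(x_k,s_k):C_x^kx_k+C_s^ks_k\ge c_k\}$. Let $Sol(P(v))$ be the set of saddle points (minimum over all $(w,x,s)\in(\mathbb R^m)^K\times\mathbb R^n\times\mathbb R^K$, maximum over all $(\eta,\lambda,\mu)$ with $\eta\in(\mathbb R^m)^K$, $\mu\in\mathbb R^m$, $\lambda=(\lambda_1,\dots,\lambda_K)$, $\lambda_k\in\mathbb R^{j_k}$, $\lambda\ge0$) of $$\sum_k\big(g_k(A_kx_k)+s_k\big)-\langle w,v_1\rangle-\langle x,v_2\rangle+\sum_k\langle E_kx_k-q_k-w_k+v_{3,k}+(P_{W^\perp}v_4)_k,\eta_k\rangle-\sum_k\langle C_x^kx_k+C_s^ks_k-c_k,\lambda_k\rangle+\Big\langle\sum_kw_k,\mu\Big\rangle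 .$$ **Theorem.** (i) Under Assumption 2 a representing triple $(C_x,C_s,c)$ exists. (ii) Given $A,E,C_x,C_s$ and the moduli $(\sigma_k),(L_k)$, there is $\tau>0$, depending on these data only, such that for all $q,g,h,X,c$ for which Assumptions 1 and 2 hold and $(C_x,C_s,c)$ represents the problem, the sets $Sol(P(0))$ and $T_{\bar L}^{-1}(0)$ are nonempty and there is $\delta>0$ (which may depend on the whole problem) such that for every $v$ with $\|v\|\le\delta$: $$\operatorname{dist}\big(z,Sol(P(0))\big)\le\tau\|v\|\quad\text{for every }z\in Sol(P(v)),$$ $$\operatorname{dist}\big(u,T_{\bar L}^{-1}(0)\big)\le2\tau\|v\|\quad\text{for every }u\in T_{\bar L}^{-1}(v).$$ -/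

import Mathlib

open scoped RealInnerProductSpace

noncomputable section

namespace ADA

/-! ### Convex analysis with extended real values -/

/-- The effective domain of an extended real valued function. -/
def effDom {F : Type*} (φ : F → EReal) : Set F := {x | φ x < ⊤}

/-- The epigraph of an extended real valued function. -/
def epigraph {F : Type*} (φ : F → EReal) : Set (F × ℝ) := {p | φ p.1 ≤ (p.2 : EReal)}

/-- Closed (lower semicontinuous) proper convex functions. -/
structure ClosedProperConvex {F : Type*} [NormedAddCommGroup F] [NormedSpace ℝ F]
    (φ : F → EReal) : Prop where
  ne_bot : ∀ x, φ x ≠ ⊥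
  nonempty_dom : (effDom φ).Nonempty
  convex : Convex ℝ (epigraph φ)
  closed : LowerSemicontinuous φ

/-- A polyhedral convex set: the solution set of finitely many affine inequalities. -/
def IsPolyhedral {F : Type*} [NormedAddCommGroup F] [NormedSpace ℝ F] (s : Set F) : Prop :=
  ∃ (N : ℕ) (a : Fin N → F →L[ℝ] ℝ) (b : Fin N → ℝ), s = {x | ∀ i, b i ≤ a i x}

/-! ### Spaces -/

/-- `ℝ^{n₁} × ⋯ × ℝ^{n_K}` with its Euclidean norm. -/
abbrev Vec {K : ℕ} (n : Fin K → ℕ) : Type :=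
  PiLp 2 (fun k : Fin K => EuclideanSpace ℝ (Fin (n k)))

/-- `(ℝ^m)^K` with its Euclidean norm. -/
abbrev Blocks (K m : ℕ) : Type := Vec (fun _ : Fin K => m)

/-- The space of points `((w, x), (η, ζ))`, and of perturbations `((v₁, v₂), (v₃, v₄))`,
with its Euclidean norm. -/
abbrev Point {K : ℕ} (m : ℕ) (n : Fin K → ℕ) : Type :=
  WithLp 2 (WithLp 2 (Blocks K m × Vec n) × WithLp 2 (Blocks K m × Blocks K m))

/-- The space of points `((w, (x, s)), (η, (λ, μ)))`, with its Euclidean norm. -/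
abbrev KKTPoint {K : ℕ} (m : ℕ) (n j : Fin K → ℕ) : Type :=
  WithLp 2 (WithLp 2 (Blocks K m × WithLp 2 (Vec n × EuclideanSpace ℝ (Fin K))) ×
    WithLp 2 (Blocks K m × WithLp 2 (Vec j × EuclideanSpace ℝ (Fin m))))

/-- The subspace `W = {w | w₁ + ⋯ + w_K = 0}` of `(ℝ^m)^K`. -/
def W (K m : ℕ) : Submodule ℝ (Blocks K m) where
  carrier := {w | ∑ k, w k = 0}
  add_mem' := by
    intro a b ha hb
    simp only [Set.mem_ofPred_eq, PiLp.add_apply, Finset.sum_add_distrib] at *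
    rw [ha, hb, add_zero]
  zero_mem' := by simp
  smul_mem' := by
    intro c a ha
    simp only [Set.mem_ofPred_eq, PiLp.smul_apply] at *
    rw [← Finset.smul_sum, ha, smul_zero]

/-- The orthogonal projection onto `W^⊥`. -/
def projWperp {K m : ℕ} (η : Blocks K m) : Blocks K m := (W K m)ᗮ.starProjection η

/-- The subspace `S = {(η, ζ) | P_{W^⊥}(η) = ζ}`. -/
def S (K m : ℕ) : Set (Blocks K m × Blocks K m) := {p | projWperp p.1 = p.2}

/-- The product `X₁ × ⋯ × X_K`. -/
def prodSet {K : ℕ} {n : Fin K → ℕ} (X : ∀ k, Set (EuclideanSpace ℝ (Fin (n k)))) :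
    Set (Vec n) := {x | ∀ k, x k ∈ X k}

/-- The right-hand side of the `k`-th block of the constraint: `q` for the last block, `0` for
the other blocks. -/
def rhs {K m : ℕ} (q : EuclideanSpace ℝ (Fin m)) (k : Fin K) : EuclideanSpace ℝ (Fin m) :=
  if (k : ℕ) + 1 = K then q else 0

/-! ### The problem and its assumptions -/

section Problem

variable {K m : ℕ} {n p : Fin K → ℕ}

/-- `f_k = g_k ∘ A_k + h_k`. -/
def blockObj (A : ∀ k, EuclideanSpace ℝ (Fin (n k)) →L[ℝ] EuclideanSpace ℝ (Fin (p k)))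
    (g : ∀ k, EuclideanSpace ℝ (Fin (p k)) → EReal)
    (h : ∀ k, EuclideanSpace ℝ (Fin (n k)) → EReal)
    (k : Fin K) (x : EuclideanSpace ℝ (Fin (n k))) : EReal :=
  g k (A k x) + h k x

/-- `f(x) = f₁(x₁) + ⋯ + f_K(x_K)`, for given blocks `f_k`. -/
def totalObj (f : ∀ k, EuclideanSpace ℝ (Fin (n k)) → EReal) (x : Vec n) : EReal :=
  ∑ k, f k (x k)

/-- The affine subspace `{x | E₁ x₁ + ⋯ + E_K x_K = q}`. -/
def linConstr (E : ∀ k, EuclideanSpace ℝ (Fin (n k)) →L[ℝ] EuclideanSpace ℝ (Fin m))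
    (q : EuclideanSpace ℝ (Fin m)) : Set (Vec n) := {x | ∑ k, E k (x k) = q}

/-- The minimum of `f` over `{x ∈ X | E x = q}` is attained, and a constraint qualification
holds. -/
structure SaddleAssumption
    (E : ∀ k, EuclideanSpace ℝ (Fin (n k)) →L[ℝ] EuclideanSpace ℝ (Fin m))
    (q : EuclideanSpace ℝ (Fin m)) (f : ∀ k, EuclideanSpace ℝ (Fin (n k)) → EReal)
    (X : ∀ k, Set (EuclideanSpace ℝ (Fin (n k)))) : Prop where
  attained : ∃ x ∈ prodSet X ∩ linConstr E q, ∀ x' ∈ prodSet X ∩ linConstr E q,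
    totalObj f x ≤ totalObj f x'
  qualification :
    (interior (prodSet X) ∩ effDom (totalObj f) ∩ linConstr E q).Nonempty ∨
      (IsPolyhedral (prodSet X) ∧
        (prodSet X ∩ interior (effDom (totalObj f)) ∩ linConstr E q).Nonempty)

/-- The structural assumption on `g_k`, `h_k` and `X_k`, with moduli `σ k` of strong convexity
and Lipschitz constants `L k`. -/
structure StructureAssumption
    (A : ∀ k, EuclideanSpace ℝ (Fin (n k)) →L[ℝ] EuclideanSpace ℝ (Fin (p k)))
    (σ L : Fin K → ℝ)
    (g : ∀ k, EuclideanSpace ℝ (Fin (p k)) → EReal)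
    (h : ∀ k, EuclideanSpace ℝ (Fin (n k)) → EReal)
    (X : ∀ k, Set (EuclideanSpace ℝ (Fin (n k)))) : Prop where
  g_cpc : ∀ k, ClosedProperConvex (g k)
  h_cpc : ∀ k, ClosedProperConvex (h k)
  g_strong : ∀ k, StrongConvexOn (effDom (g k)) (σ k) (fun y => (g k y).toReal)
  g_smooth : ∀ k, ContDiffOn ℝ 1 (fun y => (g k y).toReal) (interior (effDom (g k)))
  maps_interior : ∀ k, ∀ x ∈ X k, A k x ∈ interior (effDom (g k))
  g_lipschitz : ∀ k, ∀ x ∈ X k, ∀ x' ∈ X k,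
    ‖(A k).adjoint (gradient (fun y => (g k y).toReal) (A k x)) -
      (A k).adjoint (gradient (fun y => (g k y).toReal) (A k x'))‖ ≤ L k * ‖A k (x - x')‖
  h_polyhedral : ∀ k, IsPolyhedral (epigraph (h k))
  X_polyhedral : ∀ k, IsPolyhedral (X k)
  X_compact : ∀ k, IsCompact (X k)

/-- For every `k`, the set `{(x_k, s_k) | x_k ∈ X_k, h_k(x_k) ≤ s_k}` is the set of solutions
of the componentwise inequality `C_x^k x_k + C_s^k s_k ≥ c_k`. -/
def Represents {j : Fin K → ℕ}
    (Cx : ∀ k, EuclideanSpace ℝ (Fin (n k)) →L[ℝ] EuclideanSpace ℝ (Fin (j k)))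
    (Cs c : Vec j)
    (h : ∀ k, EuclideanSpace ℝ (Fin (n k)) → EReal)
    (X : ∀ k, Set (EuclideanSpace ℝ (Fin (n k)))) : Prop :=
  ∀ k, ∀ (x : EuclideanSpace ℝ (Fin (n k))) (s : ℝ),
    (x ∈ X k ∧ h k x ≤ (s : EReal)) ↔ ∀ i, c k i ≤ (Cx k x + s • Cs k) i

/-! ### The Lagrangian and its operator -/

/-- `L_k(x_k, η_k)`. -/
def blockLagrangian
    (E : ∀ k, EuclideanSpace ℝ (Fin (n k)) →L[ℝ] EuclideanSpace ℝ (Fin m))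
    (q : EuclideanSpace ℝ (Fin m)) (f : ∀ k, EuclideanSpace ℝ (Fin (n k)) → EReal)
    (k : Fin K) (x : EuclideanSpace ℝ (Fin (n k))) (η : EuclideanSpace ℝ (Fin m)) : EReal :=
  f k x + ((⟪η, E k x - rhs q k⟫ : ℝ) : EReal)

open Classical in
/-- The Lagrangian of the decomposed problem, as a function of `(w, x)` and `(η, ζ)`. -/
def Lbar (E : ∀ k, EuclideanSpace ℝ (Fin (n k)) →L[ℝ] EuclideanSpace ℝ (Fin m))
    (q : EuclideanSpace ℝ (Fin m)) (f : ∀ k, EuclideanSpace ℝ (Fin (n k)) → EReal)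
    (X : ∀ k, Set (EuclideanSpace ℝ (Fin (n k))))
    (w : Blocks K m) (x : Vec n) (η ζ : Blocks K m) : EReal :=
  if w ∈ W K m ∧ x ∈ prodSet X then
    if (η, ζ) ∈ S K m then
      ∑ k, (blockLagrangian E q f k (x k) (η k) - ((⟪η k, w k⟫ : ℝ) : EReal))
    else ⊥
  else ⊤

/-- `Lbar(w, x, η, ζ) - ⟨w, v₁⟩ - ⟨x, v₂⟩ + ⟨η, v₃⟩ + ⟨ζ, v₄⟩`. -/
def LbarTilted (E : ∀ k, EuclideanSpace ℝ (Fin (n k)) →L[ℝ] EuclideanSpace ℝ (Fin m))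
    (q : EuclideanSpace ℝ (Fin m)) (f : ∀ k, EuclideanSpace ℝ (Fin (n k)) → EReal)
    (X : ∀ k, Set (EuclideanSpace ℝ (Fin (n k)))) (v : Point m n)
    (w : Blocks K m) (x : Vec n) (η ζ : Blocks K m) : EReal :=
  Lbar E q f X w x η ζ +
    ((- ⟪w, v.fst.fst⟫ - ⟪x, v.fst.snd⟫ + ⟪η, v.snd.fst⟫ + ⟪ζ, v.snd.snd⟫ : ℝ) : EReal)

/-- The set-valued operator `T` of the saddle function `Lbar`: `v ∈ T(u)` iff `u` lies in
`W × X × S` and is a saddle point of the Lagrangian tilted by `v`. -/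
def TLbar (E : ∀ k, EuclideanSpace ℝ (Fin (n k)) →L[ℝ] EuclideanSpace ℝ (Fin m))
    (q : EuclideanSpace ℝ (Fin m)) (f : ∀ k, EuclideanSpace ℝ (Fin (n k)) → EReal)
    (X : ∀ k, Set (EuclideanSpace ℝ (Fin (n k)))) (u : Point m n) : Set (Point m n) :=
  {v | u.fst.fst ∈ W K m ∧ u.fst.snd ∈ prodSet X ∧ (u.snd.fst, u.snd.snd) ∈ S K m ∧
    (∀ w' ∈ W K m, ∀ x' ∈ prodSet X,
      LbarTilted E q f X v u.fst.fst u.fst.snd u.snd.fst u.snd.snd ≤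
        LbarTilted E q f X v w' x' u.snd.fst u.snd.snd) ∧
    (∀ η' ζ', (η', ζ') ∈ S K m →
      LbarTilted E q f X v u.fst.fst u.fst.snd η' ζ' ≤
        LbarTilted E q f X v u.fst.fst u.fst.snd u.snd.fst u.snd.snd)}

/-- The inverse of the operator `TLbar`. -/
def TLbarInv (E : ∀ k, EuclideanSpace ℝ (Fin (n k)) →L[ℝ] EuclideanSpace ℝ (Fin m))
    (q : EuclideanSpace ℝ (Fin m)) (f : ∀ k, EuclideanSpace ℝ (Fin (n k)) → EReal)
    (X : ∀ k, Set (EuclideanSpace ℝ (Fin (n k)))) (v : Point m n) : Set (Point m n) :=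
  {u | v ∈ TLbar E q f X u}

/-! ### The perturbed problem with explicit linear inequalities -/

/-- The canonical Lagrangian of the perturbed problem of minimizing
`∑ k, (g_k(A_k x_k) + s_k) - ⟨w, v₁⟩ - ⟨x, v₂⟩` subject to
`E_k x_k - rhs_k - w_k + v_{3,k} + (P_{W^⊥} v₄)_k = 0`, `∑ k, w_k = 0` and
`C_x^k x_k + C_s^k s_k - c_k ≥ 0`. -/
def canonLagrangian {j : Fin K → ℕ}
    (A : ∀ k, EuclideanSpace ℝ (Fin (n k)) →L[ℝ] EuclideanSpace ℝ (Fin (p k)))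
    (E : ∀ k, EuclideanSpace ℝ (Fin (n k)) →L[ℝ] EuclideanSpace ℝ (Fin m))
    (Cx : ∀ k, EuclideanSpace ℝ (Fin (n k)) →L[ℝ] EuclideanSpace ℝ (Fin (j k)))
    (Cs c : Vec j) (q : EuclideanSpace ℝ (Fin m))
    (g : ∀ k, EuclideanSpace ℝ (Fin (p k)) → EReal) (v : Point m n)
    (w : Blocks K m) (x : Vec n) (s : EuclideanSpace ℝ (Fin K))
    (η : Blocks K m) (lam : Vec j) (μ : EuclideanSpace ℝ (Fin m)) : EReal :=
  (∑ k, g k (A k (x k))) +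
    ((∑ k, s k - ⟪w, v.fst.fst⟫ - ⟪x, v.fst.snd⟫
      + ∑ k, ⟪E k (x k) - rhs q k - w k + v.snd.fst k + projWperp v.snd.snd k, η k⟫
      - ∑ k, ⟪Cx k (x k) + s k • Cs k - c k, lam k⟫
      + ⟪∑ k, w k, μ⟫ : ℝ) : EReal)

/-- `Sol(P(v))`: the saddle points of the canonical Lagrangian, which is minimized over all
`(w, x, s)` and maximized over all `(η, λ, μ)` with `λ ≥ 0`. -/
def Sol {j : Fin K → ℕ}
    (A : ∀ k, EuclideanSpace ℝ (Fin (n k)) →L[ℝ] EuclideanSpace ℝ (Fin (p k)))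
    (E : ∀ k, EuclideanSpace ℝ (Fin (n k)) →L[ℝ] EuclideanSpace ℝ (Fin m))
    (Cx : ∀ k, EuclideanSpace ℝ (Fin (n k)) →L[ℝ] EuclideanSpace ℝ (Fin (j k)))
    (Cs c : Vec j) (q : EuclideanSpace ℝ (Fin m))
    (g : ∀ k, EuclideanSpace ℝ (Fin (p k)) → EReal) (v : Point m n) :
    Set (KKTPoint m n j) :=
  {z | (∀ k i, 0 ≤ z.snd.snd.fst k i) ∧
    (∀ w' x' s',
      canonLagrangian A E Cx Cs c q g v z.fst.fst z.fst.snd.fst z.fst.snd.snd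
          z.snd.fst z.snd.snd.fst z.snd.snd.snd ≤
        canonLagrangian A E Cx Cs c q g v w' x' s' z.snd.fst z.snd.snd.fst z.snd.snd.snd) ∧
    (∀ η' lam' μ', (∀ k i, 0 ≤ lam' k i) →
      canonLagrangian A E Cx Cs c q g v z.fst.fst z.fst.snd.fst z.fst.snd.snd η' lam' μ' ≤
        canonLagrangian A E Cx Cs c q g v z.fst.fst z.fst.snd.fst z.fst.snd.snd
          z.snd.fst z.snd.snd.fst z.snd.snd.snd)}

end Problem

end ADA

end

namespace ADA

/-! ### Polyhedral sets -/

section Polyhedral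

variable {F G : Type*} [NormedAddCommGroup F] [NormedSpace ℝ F]
  [NormedAddCommGroup G] [NormedSpace ℝ G]

/-! The argument combines a Hoffman type bound for polyhedral systems with strong convexity of `g`.
A saddle point of the canonical Lagrangian is the same as a KKT point (`KKT.mem_Sol`, `Sol.kkt`).
The only nonlinear term in the KKT system is the gradient, which depends on `x` only through the
values `A_k x_k`. If the gradient and these values are moved to the right-hand side `r`, and the
active set `I` is fixed, the system `LinKKT` becomes polyhedral in `(z, r)` jointly. Fourier-Motzkin
elimination shows that the fibres of a polyhedral set are Lipschitz in the parameter and that its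
projections are polyhedral, hence closed. The resulting constant `κ` sees only `A`, `E`, `Cx`, `Cs`;
the data `q`, `c`, `v` and the gradient enter through `r`. This is why `τ` is uniform.

Given a KKT point `z` for a small `v`, its active set is also solvable for the right-hand side of
the unperturbed solutions (`exists_solvable_of_small`, by compactness of `X` and closedness of the
solvable right-hand sides; this alone determines `δ`). Hence an unperturbed solution `z'` satisfies
`‖z - z'‖ ≤ κ (2‖v‖ + (Λ + 1) a)`, where `a` is the distance between the two values of `A x` and `Λ`
is the sum of the Lipschitz moduli. Conversely, monotonicity of the KKT system and strong convexity
give `σ a² ≤ 4 ‖v‖ ‖z - z'‖` with `σ` the smallest modulus (`KKT.inner_gradMap_sub_le`). The two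
estimates together bound `a`, and then `‖z - z'‖`, by a multiple of `‖v‖`.

A saddle point of `Lbar` tilted by `v` lifts to a KKT point (`exists_kkt_of_mem_TLbarInv`), and
unperturbed KKT points project back (`KKT.toPoint_mem_TLbarInv`), so the bound transfers. Existence
and lifting both rest on Farkas' lemma, itself a consequence of the polyhedrality of projections. -/

theorem isPolyhedral_of_fintype {ι : Type*} [Fintype ι] (a : ι → F →L[ℝ] ℝ) (b : ι → ℝ) :
    IsPolyhedral {x | ∀ i, b i ≤ a i x} := by
  refine ⟨Fintype.card ι, fun i => a ((Fintype.equivFin ι).symm i),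
    fun i => b ((Fintype.equivFin ι).symm i), ?_⟩
  ext x
  exact (Fintype.equivFin ι).symm.forall_congr_left.trans (by simp) |>.symm

theorem IsPolyhedral.iInter {ι : Type*} [Fintype ι] {s : ι → Set F}
    (hs : ∀ i, IsPolyhedral (s i)) : IsPolyhedral (⋂ i, s i) := by
  choose N a b h using hs
  convert isPolyhedral_of_fintype (ι := Σ i, Fin (N i)) (fun i => a i.1 i.2)
    (fun i => b i.1 i.2) using 1
  ext x
  simp only [Set.mem_iInter, Set.mem_ofPred_eq, Sigma.forall]
  refine forall_congr' fun i => ?_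
  rw [h i]
  rfl

theorem IsPolyhedral.inter {s t : Set F} (hs : IsPolyhedral s) (ht : IsPolyhedral t) :
    IsPolyhedral (s ∩ t) := by
  rw [Set.inter_eq_iInter]
  exact IsPolyhedral.iInter fun i => by cases i <;> assumption

theorem IsPolyhedral.preimage {s : Set G} (hs : IsPolyhedral s) (f : F →L[ℝ] G) :
    IsPolyhedral (f ⁻¹' s) := by
  obtain ⟨N, a, b, rfl⟩ := hs
  exact ⟨N, fun i => (a i).comp f, b, rfl⟩

theorem IsPolyhedral.isClosed {s : Set F} (hs : IsPolyhedral s) : IsClosed s := by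
  obtain ⟨N, a, b, rfl⟩ := hs
  simp only [Set.ofPred_forall]
  exact isClosed_iInter fun i => isClosed_le continuous_const (a i).continuous

theorem isPolyhedral_le (a : F →L[ℝ] ℝ) (b : ℝ) : IsPolyhedral {x | b ≤ a x} :=
  ⟨1, fun _ => a, fun _ => b, by ext; simp⟩

theorem isPolyhedral_eq_real (a : F →L[ℝ] ℝ) (b : ℝ) : IsPolyhedral {x | a x = b} := by
  convert (isPolyhedral_le a b).inter (isPolyhedral_le (-a) (-b)) using 1
  ext x
  simp [le_antisymm_iff, and_comm]

theorem isPolyhedral_eq [FiniteDimensional ℝ G] (a : F →L[ℝ] G) (b : G) :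
    IsPolyhedral {x | a x = b} := by
  let e : G ≃L[ℝ] EuclideanSpace ℝ (Fin (Module.finrank ℝ G)) := toEuclidean
  let e' : G →L[ℝ] EuclideanSpace ℝ (Fin (Module.finrank ℝ G)) := e
  convert IsPolyhedral.iInter fun i : Fin (Module.finrank ℝ G) => isPolyhedral_eq_real
    ((EuclideanSpace.proj i : EuclideanSpace ℝ _ →L[ℝ] ℝ).comp (e'.comp a)) (e b i) using 1
  ext x
  simp only [Set.mem_ofPred_eq, Set.mem_iInter]
  rw [← e.injective.eq_iff, PiLp.ext_iff]
  rfl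

/-! ### Fourier-Motzkin elimination and Lipschitz fibres. -/

theorem exists_between_of_pairwise {ι κ : Type*} [Finite ι] [Finite κ] (l : ι → ℝ) (u : κ → ℝ)
    (h : ∀ i j, l i ≤ u j) : ∃ x, (∀ i, l i ≤ x) ∧ ∀ j, x ≤ u j := by
  rcases isEmpty_or_nonempty ι with hι | hι
  · rcases isEmpty_or_nonempty κ with hκ | hκ
    · exact ⟨0, fun i => hι.elim i, fun j => hκ.elim j⟩
    · obtain ⟨j, hj⟩ := Finite.exists_min u
      exact ⟨u j, fun i => hι.elim i, hj⟩
  · obtain ⟨i, hi⟩ := Finite.exists_max l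
    exact ⟨l i, hi, h i⟩

/-- A one-variable system of inequalities `b i ≤ a i * x + c i`, by Fourier-Motzkin elimination. -/
theorem exists_solution_iff {ι : Type*} [Finite ι] (a c b : ι → ℝ) :
    (∃ x, ∀ i, b i ≤ a i * x + c i) ↔
      ∀ i j, 0 ≤ a i → a j ≤ 0 → (a i = 0 → a j = 0) → (a j = 0 → a i = 0) →
        (-a j + if a i = 0 then 1 else 0) * (b i - c i) + a i * (b j - c j) ≤ 0 := by
  constructor
  · rintro ⟨x, hx⟩ i j hi hj hij hji
    split_ifs with h0
    · have h1 := hx i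
      simp only [h0, hij h0] at h1 ⊢
      linarith
    · nlinarith [hx i, hx j, mul_le_mul_of_nonneg_left (hx j) hi,
        mul_le_mul_of_nonneg_left (hx i) (neg_nonneg.2 hj)]
  · intro h
    obtain ⟨x, hl, hu⟩ := exists_between_of_pairwise
      (fun i : {i // 0 < a i} => (b i - c i) / a i)
      (fun j : {j // a j < 0} => (b j - c j) / a j) (by
        rintro ⟨i, hi⟩ ⟨j, hj⟩
        have := h i j hi.le hj.le (fun e => absurd e hi.ne') (fun e => absurd e hj.ne)
        rw [if_neg hi.ne', add_zero] at this
        simp only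
        rw [le_div_iff_of_neg hj, div_mul_eq_mul_div, le_div_iff₀ hi]
        nlinarith)
    refine ⟨x, fun i => ?_⟩
    rcases lt_trichotomy (a i) 0 with hi | hi | hi
    · have := hu ⟨i, hi⟩
      simp only at this
      rw [le_div_iff_of_neg hi] at this
      linarith
    -- A row with zero coefficient is paired with itself; the extra `1` in the weight turns the pair
    -- inequality into the bare condition `b i ≤ c i`.
    · have := h i i hi.ge hi.le (fun e => e) (fun e => e)
      rw [if_pos hi, hi] at this
      rw [hi]
      linarith
    · have := hl ⟨i, hi⟩
      simp only at this
      rw [div_le_iff₀ hi] at this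
      linarith

/-- The projection of a polyhedral set along a line is polyhedral. -/
theorem IsPolyhedral.image_snd_real {s : Set (ℝ × F)} (hs : IsPolyhedral s) :
    IsPolyhedral {y | ∃ x, (x, y) ∈ s} := by
  classical
  obtain ⟨N, a, b, rfl⟩ := hs
  set α : Fin N → ℝ := fun i => a i (1, 0)
  set β : Fin N → F →L[ℝ] ℝ := fun i => (a i).comp (ContinuousLinearMap.inr ℝ ℝ F)
  have hab : ∀ i x y, a i (x, y) = α i * x + β i y := by
    intro i x y
    have : ((x, y) : ℝ × F) = x • ((1, 0) : ℝ × F) + (0, y) := by simp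
    rw [this, map_add, map_smul]
    simp [α, β, mul_comm]
  let J := {p : Fin N × Fin N // 0 ≤ α p.1 ∧ α p.2 ≤ 0 ∧ (α p.1 = 0 → α p.2 = 0) ∧
    (α p.2 = 0 → α p.1 = 0)}
  let γ : Fin N × Fin N → ℝ := fun p => -α p.2 + if α p.1 = 0 then 1 else 0
  convert isPolyhedral_of_fintype (ι := J)
    (fun p => γ p.1 • β p.1.1 + α p.1.1 • β p.1.2)
    (fun p => γ p.1 * b p.1.1 + α p.1.1 * b p.1.2) using 1
  ext y
  simp only [Set.mem_ofPred_eq, hab]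
  rw [exists_solution_iff]
  constructor
  · rintro h ⟨⟨i, j⟩, h1, h2, h3, h4⟩
    have := h i j h1 h2 h3 h4
    simp only [γ, add_apply, smul_apply, smul_eq_mul]
    linarith
  · intro h i j h1 h2 h3 h4
    have := h ⟨(i, j), h1, h2, h3, h4⟩
    simp only [γ, add_apply, smul_apply,
      smul_eq_mul] at this
    linarith

/-- Fibres in `ℝ` of a polyhedral set depend on the parameter in a Lipschitz way. -/
theorem IsPolyhedral.lipschitz_fibre_real {s : Set (ℝ × F)} (hs : IsPolyhedral s) :
    ∃ κ : ℝ, 0 ≤ κ ∧ ∀ x y y', (x, y) ∈ s → (∃ x', (x', y') ∈ s) →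
      ∃ x', (x', y') ∈ s ∧ |x - x'| ≤ κ * ‖y - y'‖ := by
  obtain ⟨N, a, b, rfl⟩ := hs
  set α : Fin N → ℝ := fun i => a i (1, 0)
  set β : Fin N → F →L[ℝ] ℝ := fun i => (a i).comp (ContinuousLinearMap.inr ℝ ℝ F)
  have hab : ∀ i x y, a i (x, y) = α i * x + β i y := by
    intro i x y
    have : ((x, y) : ℝ × F) = x • ((1, 0) : ℝ × F) + (0, y) := by simp
    rw [this, map_add, map_smul]
    simp [α, β, mul_comm]
  -- Rows with `α i = 0` contribute `0` by the convention for division; they do not constrain the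
  -- variable. For the others, `‖β i‖ / |α i|` is the rate at which the bound imposed by the row
  -- moves with the parameter.
  set κ : ℝ := ∑ i, ‖β i‖ / |α i|
  have hκ : ∀ i, α i ≠ 0 → ∀ y y', |β i (y - y')| ≤ |α i| * (κ * ‖y - y'‖) := by
    intro i hi y y'
    have h1 : ‖β i‖ / |α i| ≤ κ :=
      Finset.single_le_sum (f := fun i => ‖β i‖ / |α i|) (fun i _ => by positivity)
        (Finset.mem_univ i)
    have h2 : ‖β i‖ ≤ κ * |α i| := (div_le_iff₀ (abs_pos.2 hi)).1 h1
    calc |β i (y - y')| ≤ ‖β i‖ * ‖y - y'‖ := (β i).le_opNorm _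
      _ ≤ κ * |α i| * ‖y - y'‖ := by gcongr
      _ = _ := by ring
  refine ⟨κ, Finset.sum_nonneg fun i _ => by positivity, ?_⟩
  rintro x y y' hx ⟨x₀, hx₀⟩
  simp only [Set.mem_ofPred_eq, hab] at hx hx₀ ⊢
  have hpos : 0 ≤ κ * ‖y - y'‖ :=
    mul_nonneg (Finset.sum_nonneg fun i _ => by positivity) (norm_nonneg _)
  set e := κ * ‖y - y'‖
  -- The value `none` adds the bounds `x - e` and `x + e` to those imposed by the rows at `y'`. Row
  -- bounds are mutually compatible because of `x₀`; a row bound and an added bound are compatible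
  -- because `x` satisfies the row at `y` and the row bound moves by at most `e`.
  obtain ⟨x', hl, hu⟩ := exists_between_of_pairwise
      (fun i : Option {i // 0 < α i} => i.elim (x - e) fun i => (b i - β i y') / α i)
      (fun j : Option {j // α j < 0} => j.elim (x + e) fun j => (b j - β j y') / α j) (by
        rintro (_ | ⟨i, hi⟩) (_ | ⟨j, hj⟩)
        · simp only [Option.elim]; linarith
        · simp only [Option.elim]
          rw [le_div_iff_of_neg hj]
          have h1 := hκ j hj.ne y y'
          rw [map_sub, abs_of_neg hj] at h1
          have h2 := hx j
          nlinarith [abs_le.1 h1]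
        · simp only [Option.elim]
          rw [div_le_iff₀ hi]
          have h1 := hκ i hi.ne' y y'
          rw [map_sub, abs_of_pos hi] at h1
          have h2 := hx i
          nlinarith [abs_le.1 h1]
        · simp only [Option.elim]
          have h1 : (b i - β i y') / α i ≤ x₀ := by
            rw [div_le_iff₀ hi]; linarith [hx₀ i]
          have h2 : x₀ ≤ (b j - β j y') / α j := by
            rw [le_div_iff_of_neg hj]; linarith [hx₀ j]
          exact h1.trans h2)
  refine ⟨x', fun i => ?_, ?_⟩
  · rcases lt_trichotomy (α i) 0 with hi | hi | hi
    · have := hu (some ⟨i, hi⟩)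
      simp only [Option.elim] at this
      rw [le_div_iff_of_neg hi] at this
      linarith
    · have := hx₀ i
      rw [hi] at this ⊢
      linarith
    · have := hl (some ⟨i, hi⟩)
      simp only [Option.elim] at this
      rw [div_le_iff₀ hi] at this
      linarith
  · have h1 := hl none
    have h2 := hu none
    simp only [Option.elim] at h1 h2
    rw [abs_le]
    constructor <;> linarith

/-- Both claims go through one induction on the number of eliminated coordinates: the first
coordinate is eliminated, and the hypothesis applies to what remains, which is again polyhedral. -/
theorem isPolyhedral_projection_and_lipschitz_fin (d : ℕ) :
    ∀ {F : Type*} [NormedAddCommGroup F] [NormedSpace ℝ F] {s : Set ((Fin d → ℝ) × F)},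
      IsPolyhedral s → IsPolyhedral {y | ∃ x, (x, y) ∈ s} ∧
      ∃ κ : ℝ, 0 ≤ κ ∧ ∀ x y y', (x, y) ∈ s → (∃ x', (x', y') ∈ s) →
        ∃ x', (x', y') ∈ s ∧ ‖x - x'‖ ≤ κ * ‖y - y'‖ := by
  induction d with
  | zero =>
    intro F _ _ s hs
    constructor
    · convert hs.preimage (ContinuousLinearMap.inr ℝ (Fin 0 → ℝ) F) using 1
      ext y
      constructor
      · rintro ⟨x, hx⟩
        rwa [Subsingleton.elim x 0] at hx
      · intro h
        exact ⟨0, h⟩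
    · refine ⟨0, le_rfl, ?_⟩
      rintro x y y' - ⟨x', hx'⟩
      exact ⟨x', hx', by simp [Subsingleton.elim x x']⟩
  | succ d ih =>
    intro F _ _ s hs
    let c : (ℝ × ((Fin d → ℝ) × F)) →L[ℝ] ((Fin (d + 1) → ℝ) × F) :=
      { toFun := fun p => (Fin.cons p.1 p.2.1, p.2.2)
        map_add' := fun p q => by
          refine Prod.ext (funext fun i => ?_) rfl
          refine Fin.cases ?_ (fun i => ?_) i <;> simp
        map_smul' := fun r p => by
          refine Prod.ext (funext fun i => ?_) rfl
          refine Fin.cases ?_ (fun i => ?_) i <;> simp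
        cont := by fun_prop }
    have hc := hs.preimage c
    obtain ⟨κ₁, hκ₁, h₁⟩ := hc.lipschitz_fibre_real
    obtain ⟨hp, κ₂, hκ₂, h₂⟩ := ih hc.image_snd_real
    have key : ∀ x y, (x, y) ∈ s ↔ (x 0, (Fin.tail x, y)) ∈ c ⁻¹' s := by
      intro x y
      simp [c]
    constructor
    · convert hp using 1
      ext y
      constructor
      · rintro ⟨x, hx⟩
        exact ⟨Fin.tail x, x 0, (key x y).1 hx⟩
      · rintro ⟨x, t, hx⟩
        exact ⟨_, hx⟩
    -- The tail moves by `κ₂ ‖y - y'‖`; the pair of tail and parameter then moves by at most `(κ₂ +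
    -- 1) ‖y - y'‖`, and the head follows at rate `κ₁`.
    · refine ⟨κ₁ * (κ₂ + 1) + κ₂, by positivity, ?_⟩
      rintro x y y' hx ⟨x', hx'⟩
      rw [key] at hx hx'
      obtain ⟨z, ⟨t, hz⟩, hzn⟩ := h₂ (Fin.tail x) y y' ⟨_, hx⟩ ⟨_, _, hx'⟩
      obtain ⟨t', ht', htn⟩ := h₁ (x 0) (Fin.tail x, y) (z, y') hx ⟨t, hz⟩
      refine ⟨Fin.cons t' z, ht', ?_⟩
      have hn : ‖((Fin.tail x, y) : (Fin d → ℝ) × F) - (z, y')‖ ≤ (κ₂ + 1) * ‖y - y'‖ := by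
        rw [Prod.mk_sub_mk, Prod.norm_mk]
        refine max_le ?_ ?_ <;> nlinarith [norm_nonneg (y - y')]
      have hn' : |x 0 - t'| ≤ κ₁ * ((κ₂ + 1) * ‖y - y'‖) := htn.trans (by gcongr)
      rw [pi_norm_le_iff_of_nonneg (by positivity)]
      intro i
      have h0 := norm_nonneg (y - y')
      refine Fin.cases ?_ (fun i => ?_) i
      · simp only [Pi.sub_apply, Fin.cons_zero, Real.norm_eq_abs]
        nlinarith [mul_nonneg hκ₂ h0]
      · have := (norm_le_pi_norm (Fin.tail x - z) i).trans hzn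
        simp only [Pi.sub_apply, Fin.tail] at this
        simp only [Pi.sub_apply, Fin.cons_succ]
        have : 0 ≤ κ₁ * (κ₂ + 1) * ‖y - y'‖ := by positivity
        linarith

/-- Transport of the coordinate version along a linear isomorphism. The constant depends on the set
alone, not on the parameters `y`, `y'`. -/
theorem isPolyhedral_projection_and_lipschitz [FiniteDimensional ℝ F] {s : Set (F × G)}
    (hs : IsPolyhedral s) : IsPolyhedral {y | ∃ x, (x, y) ∈ s} ∧
      ∃ κ : ℝ, 0 ≤ κ ∧ ∀ x y y', (x, y) ∈ s → (∃ x', (x', y') ∈ s) →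
        ∃ x', (x', y') ∈ s ∧ ‖x - x'‖ ≤ κ * ‖y - y'‖ := by
  let e : (Fin (Module.finrank ℝ F) → ℝ) ≃L[ℝ] F :=
    (ContinuousLinearEquiv.ofFinrankEq (by simp))
  let c : ((Fin (Module.finrank ℝ F) → ℝ) × G) →L[ℝ] F × G :=
    (e : (Fin (Module.finrank ℝ F) → ℝ) →L[ℝ] F).prodMap (ContinuousLinearMap.id ℝ G)
  obtain ⟨hp, κ, hκ, h⟩ := isPolyhedral_projection_and_lipschitz_fin _ (hs.preimage c)
  have key : ∀ x y, (x, y) ∈ s ↔ (e.symm x, y) ∈ c ⁻¹' s := by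
    intro x y
    simp [c]
  constructor
  · convert hp using 1
    ext y
    constructor
    · rintro ⟨x, hx⟩
      exact ⟨_, (key x y).1 hx⟩
    · rintro ⟨x, hx⟩
      exact ⟨_, hx⟩
  · refine ⟨‖(e : (Fin (Module.finrank ℝ F) → ℝ) →L[ℝ] F)‖ * κ, by positivity, ?_⟩
    rintro x y y' hx ⟨x', hx'⟩
    obtain ⟨z, hz, hzn⟩ := h _ _ _ ((key _ _).1 hx) ⟨_, (key _ _).1 hx'⟩
    refine ⟨e z, hz, ?_⟩
    calc ‖x - e z‖ = ‖(e : (Fin (Module.finrank ℝ F) → ℝ) →L[ℝ] F) (e.symm x - z)‖ := by simp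
      _ ≤ ‖(e : (Fin (Module.finrank ℝ F) → ℝ) →L[ℝ] F)‖ * ‖e.symm x - z‖ :=
        ContinuousLinearMap.le_opNorm _ _
      _ ≤ ‖(e : (Fin (Module.finrank ℝ F) → ℝ) →L[ℝ] F)‖ * (κ * ‖y - y'‖) := by gcongr
      _ = _ := by ring

end Polyhedral
/-! ### Linear inequalities and duality -/

section Duality

variable {V : Type*} [NormedAddCommGroup V] [InnerProductSpace ℝ V] [FiniteDimensional ℝ V]

/-- **Farkas' lemma** in a finite dimensional inner product space. -/
theorem farkas_inner {ι : Type*} [Fintype ι] (a : ι → V) (y : V)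
    (h : ∀ d, (∀ i, 0 ≤ ⟪a i, d⟫) → 0 ≤ ⟪y, d⟫) :
    ∃ c : ι → ℝ, (∀ i, 0 ≤ c i) ∧ y = ∑ i, c i • a i := by
  classical
  let S : Set ((ι → ℝ) × V) := {p | (∀ i, 0 ≤ p.1 i) ∧ ∑ i, p.1 i • a i - p.2 = 0}
  have hS : IsPolyhedral S := by
    have h1 : IsPolyhedral {p : (ι → ℝ) × V | ∀ i, 0 ≤ p.1 i} :=
      isPolyhedral_of_fintype (fun i => (ContinuousLinearMap.proj (R := ℝ) i).comp
        (ContinuousLinearMap.fst ℝ (ι → ℝ) V)) fun _ => 0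
    have h2 := isPolyhedral_eq (
      (∑ i, ((ContinuousLinearMap.proj (R := ℝ) (φ := fun _ : ι => ℝ) i).comp
        (ContinuousLinearMap.fst ℝ (ι → ℝ) V)).smulRight (a i)) -
          ContinuousLinearMap.snd ℝ (ι → ℝ) V) 0
    convert h1.inter h2 using 1
    ext p
    simp only [S, Set.mem_ofPred_eq, Set.mem_inter_iff]
    refine and_congr_right fun _ => ?_
    simp
  -- The generated cone is a projection of a polyhedral set, so it is cut out by inequalities `b k ≤
  -- φ k z`. Each `φ k` will serve as a test direction `d`.
  obtain ⟨N, φ, b, hp⟩ := (isPolyhedral_projection_and_lipschitz hS).1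
  have mem : ∀ z, (∃ c : ι → ℝ, (∀ i, 0 ≤ c i) ∧ z = ∑ i, c i • a i) ↔
      ∀ k, b k ≤ φ k z := by
    intro z
    change _ ↔ z ∈ {x | ∀ k, b k ≤ φ k x}
    rw [← hp]
    simp only [S, Set.mem_ofPred_eq, sub_eq_zero, eq_comm (a := z)]
  have hb : ∀ k, b k ≤ 0 := by
    intro k
    have := (mem 0).1 ⟨0, fun _ => le_rfl, by simp⟩ k
    simpa using this
  have hφ : ∀ k i, 0 ≤ φ k (a i) := by
    intro k i
    by_contra hneg
    push Not at hneg
    -- This multiple of `a i` lies in the cone, yet `φ k` takes there the value `b k + φ k (a i) < b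
    -- k`.
    have := (mem ((1 + b k / φ k (a i)) • a i)).1
      ⟨Pi.single i (1 + b k / φ k (a i)), fun j => by
        have : 0 ≤ b k / φ k (a i) := div_nonneg_of_nonpos (hb k) hneg.le
        by_cases hj : j = i
        · subst hj; simp; linarith
        · simp [Pi.single_eq_of_ne hj], by
        rw [Finset.sum_eq_single i]
        · simp
        · intro j _ hj; simp [Pi.single_eq_of_ne hj]
        · simp⟩ k
    rw [map_smul, smul_eq_mul, add_mul, div_mul_cancel₀ _ hneg.ne] at this
    linarith
  rw [mem]
  intro k
  have h1 := h ((InnerProductSpace.toDual ℝ V).symm (φ k)) fun i => by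
    rw [real_inner_comm, InnerProductSpace.toDual_symm_apply]
    exact hφ k i
  rw [real_inner_comm, InnerProductSpace.toDual_symm_apply] at h1
  exact (hb k).trans h1

theorem farkas {ι : Type*} [Fintype ι] (a : ι → V →L[ℝ] ℝ) (y : V →L[ℝ] ℝ)
    (h : ∀ d, (∀ i, 0 ≤ a i d) → 0 ≤ y d) :
    ∃ c : ι → ℝ, (∀ i, 0 ≤ c i) ∧ ∀ d, y d = ∑ i, c i * a i d := by
  let D := (InnerProductSpace.toDual ℝ V).symm
  obtain ⟨c, hc, hy⟩ := farkas_inner (fun i => D (a i)) (D y) fun d hd => by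
    simp only [D, InnerProductSpace.toDual_symm_apply] at hd ⊢
    exact h d hd
  refine ⟨c, hc, fun d => ?_⟩
  rw [← InnerProductSpace.toDual_symm_apply (𝕜 := ℝ) (y := y)]
  change ⟪D y, d⟫ = _
  rw [hy, sum_inner]
  simp only [D, inner_smul_left, InnerProductSpace.toDual_symm_apply]
  rfl

/-- Lagrange multipliers of a minimizer of a linear functional over a polyhedral set. -/
theorem exists_multipliers {ι : Type*} [Fintype ι] (a : ι → V →L[ℝ] ℝ) (b : ι → ℝ)
    (y : V →L[ℝ] ℝ) (z₀ : V) (h₀ : ∀ i, b i ≤ a i z₀)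
    (hmin : ∀ z, (∀ i, b i ≤ a i z) → y z₀ ≤ y z) :
    ∃ c : ι → ℝ, (∀ i, 0 ≤ c i) ∧ (∀ i, c i * (a i z₀ - b i) = 0) ∧
      ∀ d, y d = ∑ i, c i * a i d := by
  classical
  -- Inactive rows are replaced by the zero functional: a direction that respects the active rows
  -- stays feasible for small steps, so minimality gives `0 ≤ y d`.
  obtain ⟨c, hc, hy⟩ := farkas (fun i => if a i z₀ = b i then a i else 0) y fun d hd => by
    have hev : ∀ᶠ ε in nhdsWithin (0 : ℝ) (Set.Ioi 0), ∀ i, b i ≤ a i (z₀ + ε • d) := by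
      rw [Filter.eventually_all]
      intro i
      by_cases hi : a i z₀ = b i
      · filter_upwards [self_mem_nhdsWithin] with ε hε
        have := hd i
        rw [if_pos hi] at this
        rw [map_add, map_smul, hi, smul_eq_mul]
        exact le_add_of_nonneg_right (mul_nonneg (le_of_lt hε) this)
      · have hlt : b i < a i z₀ := lt_of_le_of_ne (h₀ i) (Ne.symm hi)
        have hcont : Continuous fun ε : ℝ => a i (z₀ + ε • d) := by fun_prop
        have ht : Filter.Tendsto (fun ε : ℝ => a i (z₀ + ε • d)) (nhds 0) (nhds (a i z₀)) := by
          simpa using hcont.tendsto 0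
        filter_upwards [(ht.eventually (lt_mem_nhds hlt)).filter_mono nhdsWithin_le_nhds]
          with ε hε using hε.le
    obtain ⟨ε, hε, hpos⟩ := (hev.and self_mem_nhdsWithin).exists
    have := hmin _ hε
    rw [map_add, map_smul, smul_eq_mul] at this
    have hpos' : 0 < ε := hpos
    by_contra hneg
    push Not at hneg
    nlinarith
  refine ⟨fun i => if a i z₀ = b i then c i else 0, fun i => ?_, fun i => ?_, fun d => ?_⟩
  · dsimp only; split_ifs; exacts [hc i, le_rfl]
  · dsimp only; split_ifs with h; exacts [by rw [h]; ring, by ring]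
  · rw [hy]
    refine Finset.sum_congr rfl fun i _ => ?_
    dsimp only; split_ifs <;> simp

/-- First order characterization of strong convexity at a point of differentiability. -/
theorem StrongConvexOn.gradient_le {s : Set V} {σ : ℝ} {f : V → ℝ} (hf : StrongConvexOn s σ f)
    {x y : V} (hx : x ∈ s) (hy : y ∈ s) (hd : DifferentiableAt ℝ f x) :
    f x + ⟪gradient f x, y - x⟫ + σ / 2 * ‖x - y‖ ^ 2 ≤ f y := by
  have hg : HasDerivAt (fun t : ℝ => f (x + t • (y - x))) ⟪gradient f x, y - x⟫ 0 := by
    have h1 : HasFDerivAt f ((InnerProductSpace.toDual ℝ V) (gradient f x))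
        (x + (0 : ℝ) • (y - x)) := by
      simpa using hd.hasGradientAt.hasFDerivAt
    have h2 : HasDerivAt (fun t : ℝ => x + t • (y - x)) (y - x) 0 := by
      simpa using ((hasDerivAt_id (0 : ℝ)).smul_const (y - x)).const_add x
    exact h1.comp_hasDerivAt 0 h2
  have hlim := hg.tendsto_slope_zero_right
  have hlim2 : Filter.Tendsto (fun t : ℝ => f y - f x - (1 - t) * (σ / 2 * ‖x - y‖ ^ 2))
      (nhdsWithin 0 (Set.Ioi 0)) (nhds (f y - f x - (1 - 0) * (σ / 2 * ‖x - y‖ ^ 2))) :=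
    ((by fun_prop : Continuous fun t : ℝ =>
      f y - f x - (1 - t) * (σ / 2 * ‖x - y‖ ^ 2)).tendsto 0).mono_left nhdsWithin_le_nhds
  -- Strong convexity on the segment, divided by `t`, bounds the difference quotient; the inequality
  -- follows as `t → 0+`.
  have := le_of_tendsto_of_tendsto hlim hlim2 (by
    filter_upwards [Ioo_mem_nhdsGT (zero_lt_one' ℝ)] with t ht
    have h3 := hf.2 hx hy (sub_nonneg.2 ht.2.le) ht.1.le (by ring)
    have h4 : x + t • (y - x) = (1 - t) • x + t • y := by module
    simp only [zero_add, zero_smul, add_zero, smul_eq_mul] at h3 ⊢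
    rw [h4, inv_mul_le_iff₀ ht.1]
    nlinarith)
  linarith

end Duality
/-! ### Finite sums of extended reals -/

section EReal

variable {ι : Type*} (s : Finset ι)

theorem ereal_coe_sum (f : ι → ℝ) : ((∑ i ∈ s, f i : ℝ) : EReal) = ∑ i ∈ s, (f i : EReal) := by
  classical
  induction s using Finset.induction_on with
  | empty => simp
  | insert a s ha ih => rw [Finset.sum_insert ha, Finset.sum_insert ha, EReal.coe_add, ih]

theorem ereal_sum_ne_bot {f : ι → EReal} (hf : ∀ i, f i ≠ ⊥) : ∑ i ∈ s, f i ≠ ⊥ := by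
  classical
  induction s using Finset.induction_on with
  | empty => simp
  | insert a s ha ih =>
    rw [Finset.sum_insert ha]
    exact EReal.add_ne_bot_iff.2 ⟨hf a, ih⟩

theorem ereal_sum_eq_top {f : ι → EReal} (hf : ∀ i, f i ≠ ⊥) {i : ι} (hi : i ∈ s)
    (h : f i = ⊤) : ∑ i ∈ s, f i = ⊤ := by
  classical
  rw [← Finset.add_sum_erase s f hi, h]
  exact EReal.top_add_of_ne_bot (ereal_sum_ne_bot _ hf)

theorem ereal_sum_eq_coe {f : ι → EReal} (hf : ∀ i, f i ≠ ⊥) (hf' : ∀ i, f i ≠ ⊤) :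
    ∑ i ∈ s, f i = ((∑ i ∈ s, (f i).toReal : ℝ) : EReal) := by
  rw [ereal_coe_sum]
  exact Finset.sum_congr rfl fun i _ => (EReal.coe_toReal (hf' i) (hf i)).symm

end EReal

/-! ### The linearized Karush-Kuhn-Tucker system -/

section LinKKT

variable {K m : ℕ} {n p j : Fin K → ℕ}

/-- The space of right-hand sides of the linearized system. -/
abbrev Param (m : ℕ) (n p j : Fin K → ℕ) : Type :=
  Blocks K m × Vec n × Blocks K m × Vec j × Vec p

/-- The linearized Karush-Kuhn-Tucker system with right-hand sides `r`, in which the inequalities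
in `I` are active and the multipliers outside `I` vanish. -/
structure LinKKT (A : ∀ k, EuclideanSpace ℝ (Fin (n k)) →L[ℝ] EuclideanSpace ℝ (Fin (p k)))
    (E : ∀ k, EuclideanSpace ℝ (Fin (n k)) →L[ℝ] EuclideanSpace ℝ (Fin m))
    (Cx : ∀ k, EuclideanSpace ℝ (Fin (n k)) →L[ℝ] EuclideanSpace ℝ (Fin (j k)))
    (Cs : Vec j) (I : Set (Σ k, Fin (j k))) (z : KKTPoint m n j) (r : Param m n p j) :
    Prop where
  dual_w : ∀ k, z.snd.fst k - z.snd.snd.snd + r.1 k = 0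
  dual_x : ∀ k, (E k).adjoint (z.snd.fst k) - (Cx k).adjoint (z.snd.snd.fst k) + r.2.1 k = 0
  dual_s : ∀ k, ⟪Cs k, z.snd.snd.fst k⟫ = 1
  link : ∀ k, E k (z.fst.snd.fst k) - z.fst.fst k + r.2.2.1 k = 0
  sum_w : ∑ k, z.fst.fst k = 0
  fit : ∀ k, A k (z.fst.snd.fst k) - r.2.2.2.2 k = 0
  slack : ∀ k i, r.2.2.2.1 k i ≤ (Cx k (z.fst.snd.fst k) + z.fst.snd.snd k • Cs k) i
  nonneg : ∀ k i, 0 ≤ z.snd.snd.fst k i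
  active : ∀ i : I, (Cx i.1.1 (z.fst.snd.fst i.1.1) + z.fst.snd.snd i.1.1 • Cs i.1.1) i.1.2 ≤
    r.2.2.2.1 i.1.1 i.1.2
  inactive : ∀ i : (Iᶜ : Set _), z.snd.snd.fst i.1.1 i.1.2 ≤ 0

variable (A : ∀ k, EuclideanSpace ℝ (Fin (n k)) →L[ℝ] EuclideanSpace ℝ (Fin (p k)))
    (E : ∀ k, EuclideanSpace ℝ (Fin (n k)) →L[ℝ] EuclideanSpace ℝ (Fin m))
    (Cx : ∀ k, EuclideanSpace ℝ (Fin (n k)) →L[ℝ] EuclideanSpace ℝ (Fin (j k)))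
    (Cs : Vec j)

/-- Every condition is affine in `(z, r)` jointly, since gradients and values of `A` enter only as
components of `r`, and complementarity has been replaced by the choice of `I`. -/
theorem isPolyhedral_linKKT (I : Set (Σ k, Fin (j k))) :
    IsPolyhedral {q : KKTPoint m n j × Param m n p j | LinKKT A E Cx Cs I q.1 q.2} := by
  classical
  let V := KKTPoint m n j
  let R := Param m n p j
  let z : V × R →L[ℝ] V := ContinuousLinearMap.fst ℝ V R
  let zp : V × R →L[ℝ] WithLp 2 (Blocks K m × WithLp 2 (Vec n × EuclideanSpace ℝ (Fin K))) :=
    (WithLp.fstL 2 ℝ _ _).comp z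
  let zd : V × R →L[ℝ] WithLp 2 (Blocks K m × WithLp 2 (Vec j × EuclideanSpace ℝ (Fin m))) :=
    (WithLp.sndL 2 ℝ _ _).comp z
  let w : V × R →L[ℝ] Blocks K m := (WithLp.fstL 2 ℝ _ _).comp zp
  let x : V × R →L[ℝ] Vec n := (WithLp.fstL 2 ℝ _ _).comp ((WithLp.sndL 2 ℝ _ _).comp zp)
  let s : V × R →L[ℝ] EuclideanSpace ℝ (Fin K) :=
    (WithLp.sndL 2 ℝ _ _).comp ((WithLp.sndL 2 ℝ _ _).comp zp)
  let η : V × R →L[ℝ] Blocks K m := (WithLp.fstL 2 ℝ _ _).comp zd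
  let lam : V × R →L[ℝ] Vec j := (WithLp.fstL 2 ℝ _ _).comp ((WithLp.sndL 2 ℝ _ _).comp zd)
  let μ : V × R →L[ℝ] EuclideanSpace ℝ (Fin m) :=
    (WithLp.sndL 2 ℝ _ _).comp ((WithLp.sndL 2 ℝ _ _).comp zd)
  let r1 : V × R →L[ℝ] Blocks K m :=
    (ContinuousLinearMap.fst ℝ _ _).comp (ContinuousLinearMap.snd ℝ V R)
  let r1' := (ContinuousLinearMap.snd ℝ _ _).comp (ContinuousLinearMap.snd ℝ V R)
  let r2 : V × R →L[ℝ] Vec n := (ContinuousLinearMap.fst ℝ _ _).comp r1'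
  let r2' := (ContinuousLinearMap.snd ℝ _ _).comp r1'
  let r3 : V × R →L[ℝ] Blocks K m := (ContinuousLinearMap.fst ℝ _ _).comp r2'
  let r3' := (ContinuousLinearMap.snd ℝ _ _).comp r2'
  let r4 : V × R →L[ℝ] Vec j := (ContinuousLinearMap.fst ℝ _ _).comp r3'
  let r5 : V × R →L[ℝ] Vec p := (ContinuousLinearMap.snd ℝ _ _).comp r3'
  let π (d : Fin K → ℕ) (k : Fin K) : Vec d →L[ℝ] EuclideanSpace ℝ (Fin (d k)) :=
    PiLp.proj 2 _ k
  let ρ (d : ℕ) (i : Fin d) : EuclideanSpace ℝ (Fin d) →L[ℝ] ℝ := EuclideanSpace.proj i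
  let C (k : Fin K) : V × R →L[ℝ] EuclideanSpace ℝ (Fin (j k)) :=
    (Cx k).comp ((π n k).comp x) + ((ρ K k).comp s).smulRight (Cs k)
  have h1 (k : Fin K) : IsPolyhedral
      {q : V × R | q.1.snd.fst k - q.1.snd.snd.snd + q.2.1 k = 0} :=
    isPolyhedral_eq ((π _ k).comp η - μ + (π _ k).comp r1) 0
  have h2 (k : Fin K) : IsPolyhedral {q : V × R | (E k).adjoint (q.1.snd.fst k) -
      (Cx k).adjoint (q.1.snd.snd.fst k) + q.2.2.1 k = 0} :=
    isPolyhedral_eq ((((E k).adjoint).comp ((π _ k).comp η)) -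
      (((Cx k).adjoint).comp ((π _ k).comp lam)) + (π _ k).comp r2) 0
  have h3 (k : Fin K) : IsPolyhedral {q : V × R | ⟪Cs k, q.1.snd.snd.fst k⟫ = 1} :=
    isPolyhedral_eq_real ((innerSL ℝ (Cs k)).comp ((π _ k).comp lam)) 1
  have h4 (k : Fin K) : IsPolyhedral
      {q : V × R | E k (q.1.fst.snd.fst k) - q.1.fst.fst k + q.2.2.2.1 k = 0} :=
    isPolyhedral_eq ((E k).comp ((π _ k).comp x) - (π _ k).comp w + (π _ k).comp r3) 0
  have h5 : IsPolyhedral {q : V × R | ∑ k, q.1.fst.fst k = 0} := by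
    convert isPolyhedral_eq (∑ k : Fin K, (π (fun _ => m) k).comp w) 0 using 4 with q
    rw [sum_apply]
    rfl
  have h6 (k : Fin K) : IsPolyhedral
      {q : V × R | A k (q.1.fst.snd.fst k) - q.2.2.2.2.2 k = 0} :=
    isPolyhedral_eq ((A k).comp ((π _ k).comp x) - (π _ k).comp r5) 0
  have h7 (k : Fin K) (i : Fin (j k)) : IsPolyhedral {q : V × R |
      0 ≤ (Cx k (q.1.fst.snd.fst k) + q.1.fst.snd.snd k • Cs k) i - q.2.2.2.2.1 k i} :=
    isPolyhedral_le ((ρ _ i).comp (C k) - (ρ _ i).comp ((π _ k).comp r4)) 0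
  have h8 (k : Fin K) (i : Fin (j k)) : IsPolyhedral {q : V × R | 0 ≤ q.1.snd.snd.fst k i} :=
    isPolyhedral_le ((ρ _ i).comp ((π _ k).comp lam)) 0
  have h9 (k : Fin K) (i : Fin (j k)) : IsPolyhedral {q : V × R |
      0 ≤ q.2.2.2.2.1 k i - (Cx k (q.1.fst.snd.fst k) + q.1.fst.snd.snd k • Cs k) i} :=
    isPolyhedral_le ((ρ _ i).comp ((π _ k).comp r4) - (ρ _ i).comp (C k)) 0
  have h10 (k : Fin K) (i : Fin (j k)) :
      IsPolyhedral {q : V × R | 0 ≤ -q.1.snd.snd.fst k i} :=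
    isPolyhedral_le (-(ρ _ i).comp ((π _ k).comp lam)) 0
  simp only [sub_nonneg, neg_nonneg] at h7 h9 h10
  convert (IsPolyhedral.iInter h1).inter <| (IsPolyhedral.iInter h2).inter <|
    (IsPolyhedral.iInter h3).inter <| (IsPolyhedral.iInter h4).inter <| h5.inter <|
    (IsPolyhedral.iInter h6).inter <|
    (IsPolyhedral.iInter fun k => IsPolyhedral.iInter (h7 k)).inter <|
    (IsPolyhedral.iInter fun k => IsPolyhedral.iInter (h8 k)).inter <|
    (IsPolyhedral.iInter fun i : I => h9 i.1.1 i.1.2).inter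
    (IsPolyhedral.iInter fun i : (Iᶜ : Set _) => h10 i.1.1 i.1.2) using 1
  clear h1 h2 h3 h4 h5 h6 h7 h8 h9 h10
  ext q
  simp only [Set.mem_inter_iff, Set.mem_iInter]
  exact ⟨fun ⟨k1, k2, k3, k4, k5, k6, k7, k8, k9, k10⟩ =>
    ⟨k1, k2, k3, k4, k5, k6, k7, k8, k9, k10⟩,
    fun ⟨k1, k2, k3, k4, k5, k6, k7, k8, k9, k10⟩ =>
    ⟨k1, k2, k3, k4, k5, k6, k7, k8, k9, k10⟩⟩

/-- The solutions of the linearized systems are Lipschitz in the right-hand sides. -/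
theorem exists_lipschitz_linKKT :
    ∃ κ : ℝ, 0 ≤ κ ∧ ∀ I (z : KKTPoint m n j) (r r' : Param m n p j),
      LinKKT A E Cx Cs I z r → (∃ z', LinKKT A E Cx Cs I z' r') →
        ∃ z', LinKKT A E Cx Cs I z' r' ∧ ‖z - z'‖ ≤ κ * ‖r - r'‖ := by
  classical
  choose κ hκ h using fun I =>
    (isPolyhedral_projection_and_lipschitz (isPolyhedral_linKKT A E Cx Cs I)).2
  -- There are finitely many active sets, and the sum of the nonnegative constants dominates each of
  -- them.
  refine ⟨∑ I, κ I, Finset.sum_nonneg fun I _ => hκ I, fun I z r r' hz hz' => ?_⟩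
  obtain ⟨z', h1, h2⟩ := h I z r r' hz hz'
  refine ⟨z', h1, h2.trans ?_⟩
  gcongr
  exact Finset.single_le_sum (fun I _ => hκ I) (Finset.mem_univ I)

theorem isClosed_solvable_linKKT (I : Set (Σ k, Fin (j k))) :
    IsClosed {r : Param m n p j | ∃ z, LinKKT A E Cx Cs I z r} :=
  (isPolyhedral_projection_and_lipschitz (isPolyhedral_linKKT A E Cx Cs I)).1.isClosed

end LinKKT
/-! ### The smooth part of the objective and the affine part of the Lagrangian -/

section Lagrangian

variable {K m : ℕ} {n p j : Fin K → ℕ}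

section Smooth

variable (A : ∀ k, EuclideanSpace ℝ (Fin (n k)) →L[ℝ] EuclideanSpace ℝ (Fin (p k)))
    (g : ∀ k, EuclideanSpace ℝ (Fin (p k)) → EReal)

/-- The real valued function `∑ k, g_k(A_k x_k)`. -/
noncomputable def smoothPart (x : Vec n) : ℝ := ∑ k, (g k (A k (x k))).toReal

/-- The vector with blocks `A_kᵀ ∇g_k(A_k x_k)`. -/
noncomputable def gradMap (x : Vec n) : Vec n :=
  WithLp.toLp 2 fun k => (A k).adjoint (gradient (fun y => (g k y).toReal) (A k (x k)))

/-- The vector with blocks `A_k x_k`. -/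
noncomputable def blockMap : Vec n →L[ℝ] Vec p :=
  LinearMap.toContinuousLinearMap
    { toFun := fun x => WithLp.toLp 2 fun k => A k (x k)
      map_add' := fun x y => by ext1 k; simp
      map_smul' := fun r x => by ext1 k; simp }

@[simp]
theorem blockMap_apply (x : Vec n) (k : Fin K) : blockMap A x k = A k (x k) := rfl

variable {A g} {σ L : Fin K → ℝ} {h : ∀ k, EuclideanSpace ℝ (Fin (n k)) → EReal}
  {X : ∀ k, Set (EuclideanSpace ℝ (Fin (n k)))}

theorem StructureAssumption.differentiableAt (hS : StructureAssumption A σ L g h X) {x : Vec n}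
    (hx : x ∈ prodSet X) (k : Fin K) :
    DifferentiableAt ℝ (fun y => (g k y).toReal) (A k (x k)) :=
  ((hS.g_smooth k).differentiableOn one_ne_zero).differentiableAt
    (isOpen_interior.mem_nhds (hS.maps_interior k _ (hx k)))

theorem StructureAssumption.finite_g (hS : StructureAssumption A σ L g h X) {x : Vec n}
    (hx : x ∈ prodSet X) (k : Fin K) : g k (A k (x k)) ≠ ⊤ :=
  (interior_subset (hS.maps_interior k _ (hx k))).ne

theorem inner_gradMap (x d : Vec n) :
    ⟪gradMap A g x, d⟫ =
      ∑ k, ⟪gradient (fun y => (g k y).toReal) (A k (x k)), A k (d k)⟫ := by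
  rw [PiLp.inner_apply]
  refine Finset.sum_congr rfl fun k _ => ?_
  simp only [gradMap]
  rw [ContinuousLinearMap.adjoint_inner_left]

theorem StructureAssumption.gradient_inequality (hS : StructureAssumption A σ L g h X)
    {x y : Vec n} (hx : x ∈ prodSet X) (hy : ∀ k, g k (A k (y k)) ≠ ⊤) :
    smoothPart A g x + ⟪gradMap A g x, y - x⟫ +
      ∑ k, σ k / 2 * ‖A k (x k) - A k (y k)‖ ^ 2 ≤ smoothPart A g y := by
  rw [inner_gradMap, smoothPart, smoothPart, ← Finset.sum_add_distrib, ← Finset.sum_add_distrib]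
  refine Finset.sum_le_sum fun k _ => ?_
  rw [PiLp.sub_apply, map_sub]
  exact StrongConvexOn.gradient_le (hS.g_strong k)
    (interior_subset (hS.maps_interior k _ (hx k))) (lt_top_iff_ne_top.2 (hy k))
    (hS.differentiableAt hx k)

theorem StructureAssumption.gradient_inequality_weak (hS : StructureAssumption A σ L g h X)
    (hσ : ∀ k, 0 < σ k) {x y : Vec n} (hx : x ∈ prodSet X) (hy : ∀ k, g k (A k (y k)) ≠ ⊤) :
    smoothPart A g x + ⟪gradMap A g x, y - x⟫ ≤ smoothPart A g y := by
  refine le_trans ?_ (hS.gradient_inequality hx hy)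
  exact le_add_of_nonneg_right (Finset.sum_nonneg fun k _ =>
    mul_nonneg (half_pos (hσ k)).le (sq_nonneg _))

/-- Sum of the two gradient inequalities with `x` and `y` exchanged. -/
theorem StructureAssumption.strong_monotone (hS : StructureAssumption A σ L g h X)
    {x y : Vec n} (hx : x ∈ prodSet X) (hy : y ∈ prodSet X) :
    ∑ k, σ k * ‖A k (x k) - A k (y k)‖ ^ 2 ≤ ⟪gradMap A g x - gradMap A g y, x - y⟫ := by
  have h1 := hS.gradient_inequality hx (hS.finite_g hy)
  have h2 := hS.gradient_inequality hy (hS.finite_g hx)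
  have h3 : ∑ k, σ k / 2 * ‖A k (x k) - A k (y k)‖ ^ 2 +
      ∑ k, σ k / 2 * ‖A k (y k) - A k (x k)‖ ^ 2 =
        ∑ k, σ k * ‖A k (x k) - A k (y k)‖ ^ 2 := by
    rw [← Finset.sum_add_distrib]
    refine Finset.sum_congr rfl fun k _ => ?_
    rw [norm_sub_rev (A k (y k))]
    ring
  rw [inner_sub_left, ← h3]
  rw [← neg_sub x y, inner_neg_right] at h1
  linarith

theorem StructureAssumption.hasFDerivAt_smoothPart (hS : StructureAssumption A σ L g h X)
    {x : Vec n} (hx : x ∈ prodSet X) :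
    HasFDerivAt (smoothPart A g) (innerSL ℝ (gradMap A g x)) x := by
  have key (k : Fin K) : HasFDerivAt (fun x : Vec n => (g k (A k (x k))).toReal)
      (((InnerProductSpace.toDual ℝ _) (gradient (fun y => (g k y).toReal) (A k (x k)))).comp
        ((A k).comp (PiLp.proj 2 _ k))) x := by
    have h1 := (hS.differentiableAt hx k).hasGradientAt.hasFDerivAt
    have h2 : HasFDerivAt (fun x : Vec n => A k (x k)) ((A k).comp (PiLp.proj 2 _ k)) x :=
      ContinuousLinearMap.hasFDerivAt
        ((A k).comp (PiLp.proj 2 (fun k => EuclideanSpace ℝ (Fin (n k))) k))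
    exact HasFDerivAt.comp x h1 h2
  have := HasFDerivAt.fun_sum fun k (_ : k ∈ Finset.univ) => key k
  refine this.congr_fderiv ?_
  ext d
  rw [innerSL_apply_apply, inner_gradMap, sum_apply]
  rfl

/-- The estimate is in terms of `A x` rather than `x`, because strong convexity controls only `A x`.
-/
theorem StructureAssumption.gradMap_lipschitz (hS : StructureAssumption A σ L g h X)
    {x y : Vec n} (hx : x ∈ prodSet X) (hy : y ∈ prodSet X) {Λ : ℝ} (hΛ : ∀ k, L k ≤ Λ)
    (hΛ0 : 0 ≤ Λ) :
    ‖gradMap A g x - gradMap A g y‖ ≤ Λ * ‖blockMap A x - blockMap A y‖ := by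
  rw [← map_sub]
  refine le_of_sq_le_sq ?_ (by positivity)
  rw [mul_pow, PiLp.norm_sq_eq_of_L2, PiLp.norm_sq_eq_of_L2, Finset.mul_sum]
  refine Finset.sum_le_sum fun k _ => ?_
  rw [← mul_pow]
  refine pow_le_pow_left₀ (norm_nonneg _) ?_ 2
  refine (hS.g_lipschitz k _ (hx k) _ (hy k)).trans ?_
  exact mul_le_mul_of_nonneg_right (hΛ k) (norm_nonneg _)

theorem gradMap_congr {x y : Vec n} (hxy : blockMap A x = blockMap A y) :
    gradMap A g x = gradMap A g y := by
  ext1 k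
  have := congrArg (fun z : Vec p => z k) hxy
  simp only [blockMap_apply] at this
  simp only [gradMap, this]

end Smooth

/-- The constant `v₃ + P_{W^⊥} v₄ - rhs q` in the linking constraints. -/
noncomputable def shift (q : EuclideanSpace ℝ (Fin m)) (v : Point m n) : Blocks K m :=
  WithLp.toLp 2 fun k => v.snd.fst k + projWperp v.snd.snd k - rhs q k

section Linear

variable (E : ∀ k, EuclideanSpace ℝ (Fin (n k)) →L[ℝ] EuclideanSpace ℝ (Fin m))
    (Cx : ∀ k, EuclideanSpace ℝ (Fin (n k)) →L[ℝ] EuclideanSpace ℝ (Fin (j k)))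
    (Cs c : Vec j) (q : EuclideanSpace ℝ (Fin m)) (v : Point m n)

/-- The canonical Lagrangian without its smooth part. -/
noncomputable def linPart (w : Blocks K m) (x : Vec n) (s : EuclideanSpace ℝ (Fin K))
    (η : Blocks K m) (lam : Vec j) (μ : EuclideanSpace ℝ (Fin m)) : ℝ :=
  ∑ k, s k - ⟪w, v.fst.fst⟫ - ⟪x, v.fst.snd⟫
      + ∑ k, ⟪E k (x k) - rhs q k - w k + v.snd.fst k + projWperp v.snd.snd k, η k⟫
      - ∑ k, ⟪Cx k (x k) + s k • Cs k - c k, lam k⟫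
      + ⟪∑ k, w k, μ⟫

variable (w : Blocks K m) (x : Vec n) (s : EuclideanSpace ℝ (Fin K))
    (η : Blocks K m) (lam : Vec j) (μ : EuclideanSpace ℝ (Fin m))

/-- Grouped by the dual variables: their coefficients are the constraint residuals. -/
theorem linPart_eq_dual : linPart E Cx Cs c q v w x s η lam μ =
    ∑ k, s k - ⟪w, v.fst.fst⟫ - ⟪x, v.fst.snd⟫
      + ∑ k, ⟪E k (x k) - w k + shift q v k, η k⟫
      - ∑ k, ⟪Cx k (x k) + s k • Cs k - c k, lam k⟫ + ⟪∑ k, w k, μ⟫ := by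
  unfold linPart shift
  congr 4
  ext k
  congr 1
  simp only
  abel

/-- Grouped by the primal variables: their coefficients are the stationarity residuals, up to sign
and the gradient of the smooth part. -/
theorem linPart_eq_primal : linPart E Cx Cs c q v w x s η lam μ =
    ∑ k, (s k * (1 - ⟪Cs k, lam k⟫) + ⟪w k, μ - η k - v.fst.fst k⟫ +
      ⟪x k, (E k).adjoint (η k) - (Cx k).adjoint (lam k) - v.fst.snd k⟫ +
      ⟪shift q v k, η k⟫ + ⟪c k, lam k⟫) := by
  rw [linPart_eq_dual, sum_inner, PiLp.inner_apply, PiLp.inner_apply,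
    ← Finset.sum_sub_distrib, ← Finset.sum_sub_distrib, ← Finset.sum_add_distrib,
    ← Finset.sum_sub_distrib, ← Finset.sum_add_distrib]
  refine Finset.sum_congr rfl fun k _ => ?_
  simp only [inner_add_left, inner_sub_left, inner_sub_right, real_inner_smul_left,
    ContinuousLinearMap.adjoint_inner_right]
  ring

variable {A : ∀ k, EuclideanSpace ℝ (Fin (n k)) →L[ℝ] EuclideanSpace ℝ (Fin (p k))}
    {g : ∀ k, EuclideanSpace ℝ (Fin (p k)) → EReal}

theorem canonLagrangian_eq_coe (hg : ∀ k y, g k y ≠ ⊥) (hx : ∀ k, g k (A k (x k)) ≠ ⊤) :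
    canonLagrangian A E Cx Cs c q g v w x s η lam μ =
      ((smoothPart A g x + linPart E Cx Cs c q v w x s η lam μ : ℝ) : EReal) := by
  unfold canonLagrangian
  rw [ereal_sum_eq_coe _ (fun k => hg k _) hx, ← EReal.coe_add]
  rfl

theorem canonLagrangian_eq_top (hg : ∀ k y, g k y ≠ ⊥) {k : Fin K} (hx : g k (A k (x k)) = ⊤) :
    canonLagrangian A E Cx Cs c q g v w x s η lam μ = ⊤ := by
  unfold canonLagrangian
  rw [ereal_sum_eq_top (i := k) _ (fun k => hg k _) (Finset.mem_univ _) hx]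
  exact EReal.top_add_coe _

end Linear

end Lagrangian
/-! ### Saddle points of the canonical Lagrangian -/

section Saddle

variable {K m : ℕ} {n p j : Fin K → ℕ}
  {A : ∀ k, EuclideanSpace ℝ (Fin (n k)) →L[ℝ] EuclideanSpace ℝ (Fin (p k))}
  {E : ∀ k, EuclideanSpace ℝ (Fin (n k)) →L[ℝ] EuclideanSpace ℝ (Fin m)}
  {σ L : Fin K → ℝ}
  {g : ∀ k, EuclideanSpace ℝ (Fin (p k)) → EReal}
  {h : ∀ k, EuclideanSpace ℝ (Fin (n k)) → EReal}
  {X : ∀ k, Set (EuclideanSpace ℝ (Fin (n k)))}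
  {Cx : ∀ k, EuclideanSpace ℝ (Fin (n k)) →L[ℝ] EuclideanSpace ℝ (Fin (j k))}
  {Cs c : Vec j} {q : EuclideanSpace ℝ (Fin m)} {v : Point m n}

variable (A E Cx Cs c q g v) in
/-- The Karush-Kuhn-Tucker conditions of the perturbed problem. -/
structure KKT (z : KKTPoint m n j) : Prop where
  dual_w : ∀ k, z.snd.fst k - z.snd.snd.snd + v.fst.fst k = 0
  dual_x : ∀ k, (E k).adjoint (z.snd.fst k) - (Cx k).adjoint (z.snd.snd.fst k) +
    (gradMap A g z.fst.snd.fst - v.fst.snd) k = 0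
  dual_s : ∀ k, ⟪Cs k, z.snd.snd.fst k⟫ = 1
  link : ∀ k, E k (z.fst.snd.fst k) - z.fst.fst k + shift q v k = 0
  sum_w : ∑ k, z.fst.fst k = 0
  slack : ∀ k i, c k i ≤ (Cx k (z.fst.snd.fst k) + z.fst.snd.snd k • Cs k) i
  nonneg : ∀ k i, 0 ≤ z.snd.snd.fst k i
  compl : ∀ k, ⟪Cx k (z.fst.snd.fst k) + z.fst.snd.snd k • Cs k - c k, z.snd.snd.fst k⟫ = 0

theorem inner_nonneg_of_nonneg {d : ℕ} {x y : EuclideanSpace ℝ (Fin d)} (hx : ∀ i, 0 ≤ x i)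
    (hy : ∀ i, 0 ≤ y i) : 0 ≤ ⟪x, y⟫ := by
  rw [PiLp.inner_apply]
  exact Finset.sum_nonneg fun i _ => mul_nonneg (hy i) (hx i)

theorem mul_eq_zero_of_inner_eq_zero {d : ℕ} {x y : EuclideanSpace ℝ (Fin d)}
    (hx : ∀ i, 0 ≤ x i) (hy : ∀ i, 0 ≤ y i) (hxy : ⟪x, y⟫ = 0) (i : Fin d) : y i * x i = 0 := by
  rw [PiLp.inner_apply] at hxy
  exact (Finset.sum_eq_zero_iff_of_nonneg fun i _ => mul_nonneg (hy i) (hx i)).1 hxy i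
    (Finset.mem_univ i)

theorem Represents.mem_prodSet (hR : Represents Cx Cs c h X) {x : Vec n}
    {s : EuclideanSpace ℝ (Fin K)} (hs : ∀ k i, c k i ≤ (Cx k (x k) + s k • Cs k) i) :
    x ∈ prodSet X :=
  fun k => ((hR k _ _).2 (hs k)).1

theorem KKT.mem_prodSet {z : KKTPoint m n j} (hz : KKT A E g Cx Cs c q v z)
    (hR : Represents Cx Cs c h X) : z.fst.snd.fst ∈ prodSet X :=
  hR.mem_prodSet hz.slack

/-- Stationarity reduces the affine part, as a function of the primal variables, to `-⟪∇, x⟫` plus a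
constant, so minimality is the gradient inequality. On the dual side only the nonnegative pairing of
slacks with `lam'` survives. -/
theorem KKT.mem_Sol {z : KKTPoint m n j} (hz : KKT A E g Cx Cs c q v z)
    (hS : StructureAssumption A σ L g h X) (hσ : ∀ k, 0 < σ k)
    (hR : Represents Cx Cs c h X) : z ∈ Sol A E Cx Cs c q g v := by
  have hg : ∀ k y, g k y ≠ ⊥ := fun k => (hS.g_cpc k).ne_bot
  have hx := hz.mem_prodSet hR
  refine ⟨hz.nonneg, fun w' x' s' => ?_, fun η' lam' μ' hlam => ?_⟩
  · rw [canonLagrangian_eq_coe _ _ _ _ _ _ _ _ _ _ _ _ hg (hS.finite_g hx)]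
    by_cases hfin : ∀ k, g k (A k (x' k)) ≠ ⊤
    · rw [canonLagrangian_eq_coe _ _ _ _ _ _ _ _ _ _ _ _ hg hfin, EReal.coe_le_coe_iff,
        linPart_eq_primal, linPart_eq_primal]
      have hval : ∀ (w : Blocks K m) (x : Vec n) (s : EuclideanSpace ℝ (Fin K)), ∑ k,
          (s k * (1 - ⟪Cs k, z.snd.snd.fst k⟫) +
            ⟪w k, z.snd.snd.snd - z.snd.fst k - v.fst.fst k⟫ +
            ⟪x k, (E k).adjoint (z.snd.fst k) - (Cx k).adjoint (z.snd.snd.fst k) -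
              v.fst.snd k⟫ + ⟪shift q v k, z.snd.fst k⟫ + ⟪c k, z.snd.snd.fst k⟫) =
          -⟪gradMap A g z.fst.snd.fst, x⟫ +
            ∑ k, (⟪shift q v k, z.snd.fst k⟫ + ⟪c k, z.snd.snd.fst k⟫) := by
        intro w x s
        rw [PiLp.inner_apply, ← Finset.sum_neg_distrib, ← Finset.sum_add_distrib]
        refine Finset.sum_congr rfl fun k _ => ?_
        have e1 : z.snd.snd.snd - z.snd.fst k - v.fst.fst k = 0 := by
          rw [← neg_eq_zero, ← hz.dual_w k]; abel
        have e2 : (E k).adjoint (z.snd.fst k) - (Cx k).adjoint (z.snd.snd.fst k) -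
            v.fst.snd k = -gradMap A g z.fst.snd.fst k := by
          rw [eq_neg_iff_add_eq_zero, ← hz.dual_x k, PiLp.sub_apply]; abel
        rw [e1, e2, hz.dual_s k, inner_zero_right, inner_neg_right, real_inner_comm]
        ring
      rw [hval, hval]
      have := hS.gradient_inequality_weak hσ hx hfin
      rw [inner_sub_right] at this
      linarith
    · push Not at hfin
      obtain ⟨k, hk⟩ := hfin
      rw [canonLagrangian_eq_top _ _ _ _ _ _ _ _ _ _ _ _ hg hk]
      exact le_top
  · rw [canonLagrangian_eq_coe _ _ _ _ _ _ _ _ _ _ _ _ hg (hS.finite_g hx),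
      canonLagrangian_eq_coe _ _ _ _ _ _ _ _ _ _ _ _ hg (hS.finite_g hx),
      EReal.coe_le_coe_iff, linPart_eq_dual, linPart_eq_dual, hz.sum_w]
    simp only [hz.link, hz.compl, inner_zero_left, Finset.sum_const_zero]
    have : 0 ≤ ∑ k, ⟪Cx k (z.fst.snd.fst k) + z.fst.snd.snd k • Cs k - c k, lam' k⟫ :=
      Finset.sum_nonneg fun k _ => inner_nonneg_of_nonneg
        (fun i => sub_nonneg.2 (hz.slack k i)) (hlam k)
    linarith

theorem eq_zero_of_sum_norm_sq_le {ι : Type*} [Fintype ι] {V : ι → Type*}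
    [∀ i, NormedAddCommGroup (V i)] {d : ∀ i, V i} (hd : ∑ i, ‖d i‖ ^ 2 ≤ 0) (i : ι) :
    d i = 0 := by
  have := (Finset.sum_eq_zero_iff_of_nonneg fun i _ => sq_nonneg ‖d i‖).1
    (le_antisymm hd (Finset.sum_nonneg fun i _ => sq_nonneg _)) i (Finset.mem_univ i)
  simpa using this

theorem Sol.finite_g {z : KKTPoint m n j} (hz : z ∈ Sol A E Cx Cs c q g v)
    (hS : StructureAssumption A σ L g h X) (hne : (prodSet X).Nonempty) (k : Fin K) :
    g k (A k (z.fst.snd.fst k)) ≠ ⊤ := by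
  intro htop
  obtain ⟨x', hx'⟩ := hne
  have hg : ∀ k y, g k y ≠ ⊥ := fun k => (hS.g_cpc k).ne_bot
  have := hz.2.1 0 x' 0
  rw [canonLagrangian_eq_top _ _ _ _ _ _ _ _ _ _ _ _ hg htop,
    canonLagrangian_eq_coe _ _ _ _ _ _ _ _ _ _ _ _ hg (hS.finite_g hx'), top_le_iff] at this
  exact EReal.coe_ne_top _ this

/-- Each linear residual vanishes by testing the saddle inequalities at the point moved along that
residual. The slack inequalities then place `x` in `X`, where the smooth part is differentiable, and
Fermat's rule gives stationarity in `x`. -/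
theorem Sol.kkt {z : KKTPoint m n j} (hz : z ∈ Sol A E Cx Cs c q g v)
    (hS : StructureAssumption A σ L g h X) (hR : Represents Cx Cs c h X)
    (hne : (prodSet X).Nonempty) : KKT A E g Cx Cs c q v z := by
  classical
  have hg : ∀ k y, g k y ≠ ⊥ := fun k => (hS.g_cpc k).ne_bot
  have hfin := Sol.finite_g hz hS hne
  obtain ⟨hlam, hmin, hmax⟩ := hz
  rw [canonLagrangian_eq_coe _ _ _ _ _ _ _ _ _ _ _ _ hg hfin] at hmin hmax
  have hmax' : ∀ (η' : Blocks K m) (lam' : Vec j) (μ' : EuclideanSpace ℝ (Fin m)),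
      (∀ k i, 0 ≤ lam' k i) →
      linPart E Cx Cs c q v z.fst.fst z.fst.snd.fst z.fst.snd.snd η' lam' μ' ≤
        linPart E Cx Cs c q v z.fst.fst z.fst.snd.fst z.fst.snd.snd z.snd.fst z.snd.snd.fst
          z.snd.snd.snd := by
    intro η' lam' μ' hl
    have := hmax η' lam' μ' hl
    rw [canonLagrangian_eq_coe _ _ _ _ _ _ _ _ _ _ _ _ hg hfin, EReal.coe_le_coe_iff] at this
    linarith
  have hmin' : ∀ (w' : Blocks K m) (s' : EuclideanSpace ℝ (Fin K)),
      linPart E Cx Cs c q v z.fst.fst z.fst.snd.fst z.fst.snd.snd z.snd.fst z.snd.snd.fst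
          z.snd.snd.snd ≤
      linPart E Cx Cs c q v w' z.fst.snd.fst s' z.snd.fst z.snd.snd.fst z.snd.snd.snd := by
    intro w' s'
    have := hmin w' z.fst.snd.fst s'
    rw [canonLagrangian_eq_coe _ _ _ _ _ _ _ _ _ _ _ _ hg hfin, EReal.coe_le_coe_iff] at this
    linarith
  set x := z.fst.snd.fst
  set w := z.fst.fst
  set s := z.fst.snd.snd
  set η := z.snd.fst
  set lam := z.snd.snd.fst
  set μ := z.snd.snd.snd
  have hlink : ∀ k, E k (x k) - w k + shift q v k = 0 := by
    obtain ⟨R, hRk⟩ : ∃ R : Blocks K m, ∀ k, E k (x k) - w k + shift q v k = R k :=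
      ⟨WithLp.toLp 2 fun k => E k (x k) - w k + shift q v k, fun _ => rfl⟩
    simp only [hRk]
    refine eq_zero_of_sum_norm_sq_le ?_
    have := hmax' (η + R) lam μ hlam
    rw [linPart_eq_dual, linPart_eq_dual] at this
    simp only [hRk, PiLp.add_apply, inner_add_right, Finset.sum_add_distrib,
      real_inner_self_eq_norm_sq] at this
    linarith
  have hsum : ∑ k, w k = 0 := by
    have := hmax' η lam (μ + ∑ k, w k) hlam
    rw [linPart_eq_dual, linPart_eq_dual, inner_add_right, real_inner_self_eq_norm_sq] at this
    have h0 : ‖∑ k, w k‖ ^ 2 ≤ 0 := by linarith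
    simpa using le_antisymm h0 (sq_nonneg _)
  have hineq : ∀ lam' : Vec j, (∀ k i, 0 ≤ lam' k i) →
      ∑ k, ⟪Cx k (x k) + s k • Cs k - c k, lam k⟫ ≤
        ∑ k, ⟪Cx k (x k) + s k • Cs k - c k, lam' k⟫ := by
    intro lam' hl
    have := hmax' η lam' μ hl
    rw [linPart_eq_dual, linPart_eq_dual] at this
    linarith
  have hslack : ∀ k i, c k i ≤ (Cx k (x k) + s k • Cs k) i := by
    intro k i
    -- Raising one multiplier by `1` isolates one slack.
    have := hineq (lam + PiLp.single 2 k (EuclideanSpace.single i 1)) fun k' i' => by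
      refine add_nonneg (hlam k' i') ?_
      change 0 ≤ (PiLp.single 2 k (EuclideanSpace.single i 1) : Vec j) k' i'
      by_cases hk : k' = k
      · subst hk
        rw [PiLp.single_eq_same, PiLp.single_apply]
        split_ifs <;> norm_num
      · rw [PiLp.single_eq_of_ne 2 hk]
        exact le_rfl
    simp only [PiLp.add_apply, inner_add_right, Finset.sum_add_distrib] at this
    rw [le_add_iff_nonneg_right, Finset.sum_eq_single k, PiLp.single_eq_same,
      EuclideanSpace.inner_single_right] at this
    · simpa using this
    · intro k' _ hk
      rw [PiLp.single_eq_of_ne 2 hk, inner_zero_right]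
    · simp
  have hcompl : ∀ k, ⟪Cx k (x k) + s k • Cs k - c k, lam k⟫ = 0 := by
    have hnn : ∀ k, 0 ≤ ⟪Cx k (x k) + s k • Cs k - c k, lam k⟫ := fun k =>
      inner_nonneg_of_nonneg (fun i => sub_nonneg.2 (hslack k i)) (hlam k)
    have := hineq 0 fun _ _ => le_rfl
    simp only [PiLp.zero_apply, inner_zero_right, Finset.sum_const_zero] at this
    intro k
    exact (Finset.sum_eq_zero_iff_of_nonneg fun k _ => hnn k).1
      (le_antisymm this (Finset.sum_nonneg fun k _ => hnn k)) k (Finset.mem_univ k)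
  have hdw : ∀ k, μ - η k - v.fst.fst k = 0 := by
    refine eq_zero_of_sum_norm_sq_le ?_
    have := hmin' (w - WithLp.toLp 2 fun k => μ - η k - v.fst.fst k) s
    rw [linPart_eq_primal, linPart_eq_primal] at this
    simp only [PiLp.sub_apply, inner_sub_left (𝕜 := ℝ) (w _), Finset.sum_add_distrib,
      Finset.sum_sub_distrib, real_inner_self_eq_norm_sq] at this
    linarith
  have hds : ∀ k, 1 - ⟪Cs k, lam k⟫ = 0 := by
    refine eq_zero_of_sum_norm_sq_le ?_
    have := hmin' w (s - WithLp.toLp 2 fun k => 1 - ⟪Cs k, lam k⟫)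
    rw [linPart_eq_primal, linPart_eq_primal] at this
    simp only [PiLp.sub_apply, sub_mul, Finset.sum_add_distrib,
      Finset.sum_sub_distrib, ← sq] at this
    simp only [Real.norm_eq_abs, sq_abs]
    linarith
  have hx : x ∈ prodSet X := hR.mem_prodSet hslack
  set D : Vec n := WithLp.toLp 2 fun k =>
    (E k).adjoint (η k) - (Cx k).adjoint (lam k) - v.fst.snd k
  have hdx : innerSL ℝ (gradMap A g x) + innerSL ℝ D = 0 := by
    have hloc : IsLocalMin (fun x' => smoothPart A g x' + innerSL ℝ D x') x := by
      have hnhds : ∀ᶠ x' : Vec n in nhds x, ∀ k, A k (x' k) ∈ interior (effDom (g k)) := by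
        rw [Filter.eventually_all]
        intro k
        have hc : Continuous fun x' : Vec n => A k (x' k) := by fun_prop
        exact hc.continuousAt.eventually (isOpen_interior.mem_nhds (hS.maps_interior k _ (hx k)))
      filter_upwards [hnhds] with x' hx'
      have := hmin w x' s
      rw [canonLagrangian_eq_coe _ _ _ _ _ _ _ _ _ _ _ _ hg
        (fun k => (interior_subset (hx' k)).ne), EReal.coe_le_coe_iff, linPart_eq_primal,
        linPart_eq_primal] at this
      simp only [Finset.sum_add_distrib] at this
      simp only [innerSL_apply_apply]
      rw [real_inner_comm, real_inner_comm x' D, PiLp.inner_apply, PiLp.inner_apply]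
      simp only [D]
      linarith
    exact hloc.hasFDerivAt_eq_zero
      ((hS.hasFDerivAt_smoothPart hx).add (innerSL ℝ D).hasFDerivAt)
  have hdx' : gradMap A g x + D = 0 := by
    rw [← map_add] at hdx
    rw [← norm_eq_zero, ← innerSL_apply_norm (𝕜 := ℝ), hdx, norm_zero]
  refine ⟨fun k => ?_, fun k => ?_, fun k => by linarith [hds k], hlink, hsum, hslack, hlam,
    hcompl⟩
  · rw [← neg_eq_zero, ← hdw k]; abel
  · have := congrArg (fun y : Vec n => y k) hdx'
    simp only [PiLp.add_apply, PiLp.zero_apply, D] at this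
    rw [← this, PiLp.sub_apply]
    abel

end Saddle
/-! ### The error bound for the saddle points of the canonical Lagrangian -/

section ErrorBound

variable {K m : ℕ} {n p j : Fin K → ℕ}
  {A : ∀ k, EuclideanSpace ℝ (Fin (n k)) →L[ℝ] EuclideanSpace ℝ (Fin (p k))}
  {E : ∀ k, EuclideanSpace ℝ (Fin (n k)) →L[ℝ] EuclideanSpace ℝ (Fin m)}
  {σ L : Fin K → ℝ}
  {g : ∀ k, EuclideanSpace ℝ (Fin (p k)) → EReal}
  {h : ∀ k, EuclideanSpace ℝ (Fin (n k)) → EReal}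
  {X : ∀ k, Set (EuclideanSpace ℝ (Fin (n k)))}
  {Cx : ∀ k, EuclideanSpace ℝ (Fin (n k)) →L[ℝ] EuclideanSpace ℝ (Fin (j k))}
  {Cs c : Vec j} {q : EuclideanSpace ℝ (Fin m)} {v : Point m n}

variable (A g c q) in
/-- The right-hand sides of the linearized system at `x` for the perturbation `v`. -/
noncomputable def param (v : Point m n) (x : Vec n) : Param m n p j :=
  (v.fst.fst, gradMap A g x - v.fst.snd, shift q v, c, blockMap A x)

/-- `I` is the set of rows active at `z`; complementarity kills the multipliers outside it. -/
theorem KKT.exists_linKKT {z : KKTPoint m n j} (hz : KKT A E g Cx Cs c q v z) :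
    ∃ I, LinKKT A E Cx Cs I z (param A g c q v z.fst.snd.fst) := by
  refine ⟨{i | (Cx i.1 (z.fst.snd.fst i.1) + z.fst.snd.snd i.1 • Cs i.1) i.2 ≤ c i.1 i.2},
    hz.dual_w, hz.dual_x, hz.dual_s, hz.link, hz.sum_w, fun k => sub_self _, hz.slack,
    hz.nonneg, fun i => i.2, ?_⟩
  rintro ⟨⟨k, i⟩, hi⟩
  have hi' : c k i < (Cx k (z.fst.snd.fst k) + z.fst.snd.snd k • Cs k) i := not_le.1 hi
  have := mul_eq_zero_of_inner_eq_zero (fun i => sub_nonneg.2 (hz.slack k i)) (hz.nonneg k)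
    (hz.compl k) i
  rcases mul_eq_zero.1 this with h0 | h0
  · exact h0.le
  · exact absurd h0 (sub_pos.2 hi').ne'

theorem LinKKT.blockMap_eq {I : Set (Σ k, Fin (j k))} {z : KKTPoint m n j} {x : Vec n}
    (hz : LinKKT A E Cx Cs I z (param A g c q v x)) :
    blockMap A z.fst.snd.fst = blockMap A x := by
  ext1 k
  exact sub_eq_zero.1 (hz.fit k)

/-- The base point `x` need not be the `x`-component of `z`: the condition `fit` makes their images
under `A` agree, hence also their gradients. -/
theorem LinKKT.kkt {I : Set (Σ k, Fin (j k))} {z : KKTPoint m n j} {x : Vec n}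
    (hz : LinKKT A E Cx Cs I z (param A g c q v x)) : KKT A E g Cx Cs c q v z := by
  refine ⟨hz.dual_w, fun k => ?_, hz.dual_s, hz.link, hz.sum_w, hz.slack, hz.nonneg,
    fun k => ?_⟩
  · rw [gradMap_congr hz.blockMap_eq]
    exact hz.dual_x k
  · rw [PiLp.inner_apply]
    refine Finset.sum_eq_zero fun i _ => ?_
    by_cases hi : (⟨k, i⟩ : Σ k, Fin (j k)) ∈ I
    · have h1 := le_antisymm (hz.active ⟨_, hi⟩) (hz.slack k i)
      have h2 : (Cx k (z.fst.snd.fst k) + z.fst.snd.snd k • Cs k - c k) i = 0 := sub_eq_zero.2 h1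
      rw [h2, inner_zero_left]
    · have h1 := le_antisymm (hz.inactive ⟨_, hi⟩) (hz.nonneg k i)
      dsimp only at h1
      rw [h1, inner_zero_right]

theorem param_congr {x y : Vec n} (hxy : blockMap A x = blockMap A y) :
    (param A g c q v x : Param m n p j) = param A g c q v y := by
  unfold param
  rw [gradMap_congr hxy, hxy]

theorem shift_zero (k : Fin K) : shift q (0 : Point m n) k = -rhs q k := by
  have : projWperp (0 : Blocks K m) = 0 := map_zero _
  change (0 : EuclideanSpace ℝ (Fin m)) + projWperp (0 : Blocks K m) k - rhs q k = _
  rw [this]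
  simp

theorem shift_sub_shift_zero :
    shift q v - shift q (0 : Point m n) = v.snd.fst + projWperp v.snd.snd := by
  ext1 k
  rw [PiLp.sub_apply, shift_zero]
  simp [shift]

theorem norm_shift_sub_le : ‖shift q v - shift q (0 : Point m n)‖ ≤ 2 * ‖v‖ := by
  rw [shift_sub_shift_zero]
  have h1 : ‖v.snd.fst‖ ≤ ‖v‖ := (WithLp.norm_fst_le _ _).trans (WithLp.norm_snd_le _ _)
  have h2 : ‖v.snd.snd‖ ≤ ‖v‖ := (WithLp.norm_snd_le _ _).trans (WithLp.norm_snd_le _ _)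
  have h3 : ‖projWperp v.snd.snd‖ ≤ ‖v.snd.snd‖ :=
    Submodule.norm_starProjection_apply_le _ _
  linarith [norm_add_le v.snd.fst (projWperp v.snd.snd)]

/-- After subtraction of the two systems, the terms in `E` leave only perturbations and a `μ` term,
the `μ` term vanishes because both `w` sum to zero, and the multiplier term has a favourable sign.
The factor `4` is `1 + 1 + 2`, from `v₂`, `v₁` and the shift. -/
theorem KKT.inner_gradMap_sub_le {z z' : KKTPoint m n j} (hz : KKT A E g Cx Cs c q v z)
    (hz' : KKT A E g Cx Cs c q 0 z') :
    ⟪gradMap A g z.fst.snd.fst - gradMap A g z'.fst.snd.fst,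
      z.fst.snd.fst - z'.fst.snd.fst⟫ ≤ 4 * ‖v‖ * ‖z - z'‖ := by
  set x := z.fst.snd.fst
  set x' := z'.fst.snd.fst
  set w := z.fst.fst
  set w' := z'.fst.fst
  set s := z.fst.snd.snd
  set s' := z'.fst.snd.snd
  set η := z.snd.fst
  set η' := z'.snd.fst
  set lam := z.snd.snd.fst
  set lam' := z'.snd.snd.fst
  set μ := z.snd.snd.snd
  set μ' := z'.snd.snd.snd
  have key : ⟪gradMap A g x - gradMap A g x', x - x'⟫ ≤
      ⟪v.fst.snd, x - x'⟫ + ⟪v.fst.fst, w - w'⟫ + ⟪shift q v - shift q (0 : Point m n), η - η'⟫ := by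
    have hμ : ∑ k, ⟪μ - μ', w k - w' k⟫ = 0 := by
      rw [← inner_sum, Finset.sum_sub_distrib, hz.sum_w, hz'.sum_w, sub_zero, inner_zero_right]
    -- The vanishing `μ` sum is inserted so that the inequality can be checked block by block.
    rw [← sub_zero (⟪v.fst.snd, x - x'⟫ + ⟪v.fst.fst, w - w'⟫ +
      ⟪shift q v - shift q (0 : Point m n), η - η'⟫), ← hμ]
    simp only [PiLp.inner_apply (x := gradMap A g x - gradMap A g x'),
      PiLp.inner_apply (x := v.fst.snd), PiLp.inner_apply (x := v.fst.fst),
      PiLp.inner_apply (x := shift q v - shift q (0 : Point m n))]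
    rw [← Finset.sum_add_distrib, ← Finset.sum_add_distrib, ← Finset.sum_sub_distrib]
    refine Finset.sum_le_sum fun k _ => ?_
    simp only [PiLp.sub_apply]
    have e1 : gradMap A g x k - gradMap A g x' k = v.fst.snd k -
        (E k).adjoint (η k - η' k) + (Cx k).adjoint (lam k - lam' k) := by
      have h1 := hz.dual_x k
      have h2 := hz'.dual_x k
      rw [PiLp.sub_apply] at h1 h2
      have h3 : (0 : Point m n).fst.snd k = 0 := rfl
      rw [h3, sub_zero] at h2
      have h4 := congrArg₂ (· - ·) h1 h2
      simp only [sub_zero] at h4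
      rw [map_sub, map_sub, ← sub_eq_zero, ← h4]
      abel
    have e2 : E k (x k - x' k) = (w k - w' k) - (shift q v k - shift q (0 : Point m n) k) := by
      have h4 := congrArg₂ (· - ·) (hz.link k) (hz'.link k)
      simp only [sub_zero] at h4
      rw [map_sub, ← sub_eq_zero, ← h4]
      abel
    have e3 : v.fst.fst k = (μ - μ') - (η k - η' k) := by
      have h3 : (0 : Point m n).fst.fst k = 0 := rfl
      have h4 := congrArg₂ (· - ·) (hz.dual_w k) (hz'.dual_w k)
      simp only [sub_zero, h3] at h4
      rw [← sub_eq_zero, ← h4]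
      abel
    -- The normalization `⟪Cs k, lam k⟫ = 1` of both multipliers removes `s`; by complementarity
    -- only minus the nonnegative cross products remain.
    have e4 : ⟪lam k - lam' k, Cx k (x k - x' k)⟫ ≤ 0 := by
      have h1 : Cx k (x k - x' k) = (Cx k (x k) + s k • Cs k - c k) -
          (Cx k (x' k) + s' k • Cs k - c k) - (s k - s' k) • Cs k := by
        rw [map_sub]; module
      have h2 : ⟪lam k - lam' k, Cs k⟫ = 0 := by
        rw [inner_sub_left, real_inner_comm, hz.dual_s k, real_inner_comm, hz'.dual_s k, sub_self]
      have h3 : 0 ≤ ⟪Cx k (x k) + s k • Cs k - c k, lam' k⟫ :=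
        inner_nonneg_of_nonneg (fun i => sub_nonneg.2 (hz.slack k i)) (hz'.nonneg k)
      have h4 : 0 ≤ ⟪Cx k (x' k) + s' k • Cs k - c k, lam k⟫ :=
        inner_nonneg_of_nonneg (fun i => sub_nonneg.2 (hz'.slack k i)) (hz.nonneg k)
      have h5 := hz.compl k
      have h6 := hz'.compl k
      rw [h1, inner_sub_right, inner_smul_right, h2, real_inner_comm, inner_sub_left,
        inner_sub_right, inner_sub_right]
      linarith
    rw [e1, inner_add_left, inner_sub_left, ContinuousLinearMap.adjoint_inner_left,
      ContinuousLinearMap.adjoint_inner_left, e2, e3,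
      inner_sub_right (η k - η' k), inner_sub_left (μ - μ'),
      real_inner_comm (η k - η' k) (shift q v k - shift q (0 : Point m n) k)]
    linarith
  have n1 : ‖x - x'‖ ≤ ‖z - z'‖ :=
    ((WithLp.norm_fst_le _ (z - z').fst.snd).trans (WithLp.norm_snd_le _ (z - z').fst)).trans
      (WithLp.norm_fst_le _ (z - z'))
  have n2 : ‖w - w'‖ ≤ ‖z - z'‖ :=
    (WithLp.norm_fst_le _ (z - z').fst).trans (WithLp.norm_fst_le _ (z - z'))
  have n3 : ‖η - η'‖ ≤ ‖z - z'‖ :=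
    (WithLp.norm_fst_le _ (z - z').snd).trans (WithLp.norm_snd_le _ (z - z'))
  have m1 : ‖v.fst.fst‖ ≤ ‖v‖ := (WithLp.norm_fst_le _ _).trans (WithLp.norm_fst_le _ _)
  have m2 : ‖v.fst.snd‖ ≤ ‖v‖ := (WithLp.norm_snd_le _ _).trans (WithLp.norm_fst_le _ _)
  have b1 : ⟪v.fst.snd, x - x'⟫ ≤ ‖v‖ * ‖z - z'‖ := (real_inner_le_norm _ _).trans (by gcongr)
  have b2 : ⟪v.fst.fst, w - w'⟫ ≤ ‖v‖ * ‖z - z'‖ := (real_inner_le_norm _ _).trans (by gcongr)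
  have b3 : ⟪shift q v - shift q (0 : Point m n), η - η'⟫ ≤ 2 * ‖v‖ * ‖z - z'‖ :=
    (real_inner_le_norm _ _).trans (by gcongr; exact norm_shift_sub_le)
  linarith

theorem isCompact_prodSet (hX : ∀ k, IsCompact (X k)) : IsCompact (prodSet X) := by
  convert (isCompact_univ_pi hX).image (PiLp.continuous_toLp 2 _) using 1
  ext x
  constructor
  · intro hx
    exact ⟨WithLp.ofLp x, fun k _ => hx k, rfl⟩
  · rintro ⟨y, hy, rfl⟩ k
    exact hy k trivial

theorem norm_param_sub_le (x : Vec n) :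
    ‖(param A g c q v x : Param m n p j) - param A g c q 0 x‖ ≤ 2 * ‖v‖ := by
  have m1 : ‖v.fst.fst‖ ≤ ‖v‖ := (WithLp.norm_fst_le _ _).trans (WithLp.norm_fst_le _ _)
  have m2 : ‖v.fst.snd‖ ≤ ‖v‖ := (WithLp.norm_snd_le _ _).trans (WithLp.norm_fst_le _ _)
  have h0 := norm_nonneg v
  have e1 : (0 : Point m n).fst.fst = 0 := rfl
  have e2 : (0 : Point m n).fst.snd = 0 := rfl
  simp only [param, Prod.mk_sub_mk, Prod.norm_mk, e1, e2, sub_self, norm_zero, sub_zero]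
  refine max_le (by linarith) (max_le ?_ (max_le norm_shift_sub_le (by positivity)))
  rw [sub_sub_cancel_left, norm_neg]
  linarith

theorem StructureAssumption.continuousOn_param (hS : StructureAssumption A σ L g h X)
    (hL : ∀ k, 0 ≤ L k) :
    ContinuousOn (fun x => (param A g c q v x : Param m n p j)) (prodSet X) := by
  have hΛ : ∀ k, L k ≤ ∑ k, L k := fun k =>
    Finset.single_le_sum (fun k _ => hL k) (Finset.mem_univ k)
  have hΛ0 : 0 ≤ ∑ k, L k := Finset.sum_nonneg fun k _ => hL k
  have hg : ContinuousOn (gradMap A g) (prodSet X) := by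
    refine LipschitzOnWith.continuousOn
      (K := Real.toNNReal ((∑ k, L k) * ‖blockMap A‖)) ?_
    refine LipschitzOnWith.of_dist_le_mul fun x hx y hy => ?_
    rw [dist_eq_norm, dist_eq_norm]
    refine (hS.gradMap_lipschitz hx hy hΛ hΛ0).trans ?_
    rw [← map_sub, Real.coe_toNNReal _ (by positivity), mul_assoc]
    gcongr
    exact (blockMap A).le_opNorm _
  unfold param
  fun_prop

/-- Right-hand sides that occur for small perturbations and admit a given active set also admit
this active set for the unperturbed problem. -/
theorem exists_solvable_of_small (hS : StructureAssumption A σ L g h X) (hL : ∀ k, 0 ≤ L k)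
    (x₀ : Vec n)
    (huniq : ∀ z, KKT A E g Cx Cs c q 0 z → blockMap A z.fst.snd.fst = blockMap A x₀) :
    ∃ δ : ℝ, 0 < δ ∧ ∀ v : Point m n, ‖v‖ ≤ δ → ∀ x ∈ prodSet X, ∀ I,
      (∃ z, LinKKT A E Cx Cs I z (param A g c q v x)) →
        ∃ z, LinKKT A E Cx Cs I z (param A g c q 0 x₀) := by
  classical
  -- `D` collects the right-hand sides solvable with some active set that fails at the unperturbed
  -- solution. It is a finite union of closed sets.
  let D : Set (Param m n p j) :=
    ⋃ I : {I : Set (Σ k, Fin (j k)) // ¬∃ z, LinKKT A E Cx Cs I z (param A g c q 0 x₀)},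
      {r | ∃ z, LinKKT A E Cx Cs I.1 z r}
  have hD : IsClosed D := isClosed_iUnion_of_finite fun I => isClosed_solvable_linKKT A E Cx Cs I.1
  have hK : IsCompact ((fun x => (param A g c q 0 x : Param m n p j)) '' prodSet X) :=
    (isCompact_prodSet hS.X_compact).image_of_continuousOn (hS.continuousOn_param hL)
  -- The unperturbed right-hand sides over `X` form a compact set disjoint from `D`: a solution at
  -- such a point is a KKT point, so by uniqueness of `A x` its right-hand side is the one at `x₀`.
  obtain ⟨δ, hδ, hsub⟩ := hK.exists_thickening_subset_open hD.isOpen_compl (by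
    rintro _ ⟨x, -, rfl⟩ hx
    obtain ⟨⟨I, hI⟩, z, hz⟩ := Set.mem_iUnion.1 hx
    refine hI ⟨z, ?_⟩
    rw [← param_congr (huniq z hz.kkt), param_congr hz.blockMap_eq]
    exact hz)
  refine ⟨δ / 4, by positivity, fun v hv x hx I hI => ?_⟩
  by_contra hcon
  refine hsub (Metric.mem_thickening_iff.2 ⟨param A g c q 0 x, ⟨x, hx, rfl⟩, ?_⟩)
    (Set.mem_iUnion.2 ⟨⟨I, hcon⟩, hI⟩)
  rw [dist_eq_norm]
  linarith [norm_param_sub_le (A := A) (g := g) (c := c) (q := q) (v := v) x]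

variable (A E Cx Cs) in
/-- The upper Lipschitz property of the saddle points of the canonical Lagrangian. -/
theorem exists_error_bound_Sol (hK : 0 < K) (hσ : ∀ k, 0 < σ k) (hL : ∀ k, 0 ≤ L k) :
    ∃ τ : ℝ, 0 < τ ∧
      ∀ (q : EuclideanSpace ℝ (Fin m))
        (g : ∀ k, EuclideanSpace ℝ (Fin (p k)) → EReal)
        (h : ∀ k, EuclideanSpace ℝ (Fin (n k)) → EReal)
        (X : ∀ k, Set (EuclideanSpace ℝ (Fin (n k)))) (c : Vec j),
        StructureAssumption A σ L g h X → Represents Cx Cs c h X →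
        (prodSet X).Nonempty →
        (Sol A E Cx Cs c q g 0).Nonempty →
        ∃ δ : ℝ, 0 < δ ∧ ∀ v : Point m n, ‖v‖ ≤ δ → ∀ z ∈ Sol A E Cx Cs c q g v,
          ∃ z' ∈ Sol A E Cx Cs c q g 0, ‖z - z'‖ ≤ τ * ‖v‖ := by
  have : Nonempty (Fin K) := ⟨⟨0, hK⟩⟩
  obtain ⟨k₀, hk₀⟩ := Finite.exists_min σ
  obtain ⟨κ, hκ, hlip⟩ := exists_lipschitz_linKKT (m := m) A E Cx Cs
  have hΛ : ∀ k, L k ≤ ∑ k, L k := fun k =>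
    Finset.single_le_sum (fun k _ => hL k) (Finset.mem_univ k)
  have hΛ0 : 0 ≤ ∑ k, L k := Finset.sum_nonneg fun k _ => hL k
  set Λ := ∑ k, L k
  have hσ₀ := hσ k₀
  -- Chosen so that `a ≤ B ‖v‖`: the `1` covers `a ≤ ‖v‖`; otherwise `2‖v‖ + (Λ + 1) a ≤ (Λ + 3) a`,
  -- and one factor `a` cancels in the quadratic estimate.
  set B : ℝ := 1 + 4 * κ * (Λ + 3) / σ k₀
  have hB : 0 ≤ B := by positivity
  -- The final `+ 1` only ensures positivity, since `κ` may be `0`.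
  refine ⟨κ * (2 + (Λ + 1) * B) + 1, by positivity, ?_⟩
  intro q g h X c hS hR hne ⟨z₀, hz₀⟩
  have hk₀' := Sol.kkt hz₀ hS hR hne
  set x₀ := z₀.fst.snd.fst
  have hest : ∀ {v : Point m n} {z z' : KKTPoint m n j}, KKT A E g Cx Cs c q v z →
      KKT A E g Cx Cs c q 0 z' →
      σ k₀ * ‖blockMap A z.fst.snd.fst - blockMap A z'.fst.snd.fst‖ ^ 2 ≤
        4 * ‖v‖ * ‖z - z'‖ := by
    intro v z z' hz hz'
    refine le_trans ?_ (hz.inner_gradMap_sub_le hz')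
    refine le_trans ?_ (hS.strong_monotone (hz.mem_prodSet hR) (hz'.mem_prodSet hR))
    rw [PiLp.norm_sq_eq_of_L2, Finset.mul_sum]
    exact Finset.sum_le_sum fun k _ => mul_le_mul_of_nonneg_right (hk₀ k) (sq_nonneg _)
  have huniq : ∀ z, KKT A E g Cx Cs c q 0 z →
      blockMap A z.fst.snd.fst = blockMap A x₀ := by
    intro z hz
    have := hest hz hk₀'
    rw [norm_zero, mul_zero, zero_mul] at this
    have h1 : ‖blockMap A z.fst.snd.fst - blockMap A x₀‖ ^ 2 ≤ 0 := by
      by_contra hpos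
      push Not at hpos
      exact absurd this (not_le.2 (mul_pos hσ₀ hpos))
    exact sub_eq_zero.1 (norm_eq_zero.1 (pow_eq_zero_iff two_ne_zero |>.1
      (le_antisymm h1 (sq_nonneg _))))
  obtain ⟨δ, hδ, hsolv⟩ := exists_solvable_of_small hS hL x₀ huniq
  refine ⟨δ, hδ, fun v hv z hz => ?_⟩
  have hzk := Sol.kkt hz hS hR hne
  have hx := hzk.mem_prodSet hR
  obtain ⟨I, hI⟩ := hzk.exists_linKKT
  -- The active set of `z` is kept while the right-hand side changes from that of `(v, x)` to that
  -- of `(0, x₀)`.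
  obtain ⟨z', hz', hzz'⟩ := hlip I z _ _ hI (hsolv v hv _ hx I ⟨z, hI⟩)
  have hz'k := hz'.kkt
  refine ⟨z', hz'k.mem_Sol hS hσ hR, ?_⟩
  set x := z.fst.snd.fst
  set a := ‖blockMap A x - blockMap A x₀‖
  have ha : 0 ≤ a := norm_nonneg _
  have hv0 := norm_nonneg v
  have hr : ‖(param A g c q v x : Param m n p j) - param A g c q 0 x₀‖ ≤
      2 * ‖v‖ + (Λ + 1) * a := by
    have h1 := norm_param_sub_le (A := A) (g := g) (c := c) (q := q) (v := v) x
    have h2 : ‖(param A g c q 0 x : Param m n p j) - param A g c q 0 x₀‖ ≤ (Λ + 1) * a := by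
      have h3 := hS.gradMap_lipschitz hx (hk₀'.mem_prodSet hR) hΛ hΛ0
      simp only [param, Prod.mk_sub_mk, Prod.norm_mk, sub_self, norm_zero, sub_sub_sub_cancel_right]
      refine max_le (by positivity) (max_le ?_ (max_le (by positivity)
        (max_le (by positivity) ?_)))
      · refine h3.trans ?_
        nlinarith
      · nlinarith [mul_nonneg hΛ0 ha]
    exact (norm_sub_le_norm_sub_add_norm_sub _ _ _).trans (add_le_add h1 h2)
  have hd : ‖z - z'‖ ≤ κ * (2 * ‖v‖ + (Λ + 1) * a) := hzz'.trans (by gcongr)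
  have haB : a ≤ B * ‖v‖ := by
    have h1 := hest hzk hz'k
    rw [huniq z' hz'k] at h1
    have h2 : 0 ≤ 4 * κ * (Λ + 3) / σ k₀ := by positivity
    rcases le_or_gt a ‖v‖ with hle | hlt
    · refine hle.trans ?_
      exact le_mul_of_one_le_left hv0 (le_add_of_nonneg_right h2)
    · have h3 : σ k₀ * a ^ 2 ≤ 4 * ‖v‖ * (κ * ((Λ + 3) * a)) := by
        refine h1.trans ?_
        gcongr
        refine hd.trans ?_
        gcongr
        linarith
      have hapos : 0 < a := hv0.trans_lt hlt
      have h4 : σ k₀ * a ≤ 4 * κ * (Λ + 3) * ‖v‖ := by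
        refine le_of_mul_le_mul_right ?_ hapos
        nlinarith
      have h5 : a ≤ 4 * κ * (Λ + 3) / σ k₀ * ‖v‖ := by
        rw [div_mul_eq_mul_div, le_div_iff₀ hσ₀]
        linarith
      refine h5.trans ?_
      gcongr
      exact le_add_of_nonneg_left zero_le_one
  calc ‖z - z'‖ ≤ κ * (2 * ‖v‖ + (Λ + 1) * (B * ‖v‖)) := hd.trans (by gcongr)
    _ = κ * (2 + (Λ + 1) * B) * ‖v‖ := by ring
    _ ≤ _ := by gcongr; linarith

end ErrorBound
/-! ### Multipliers of minimizers -/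

section Multipliers

variable {K m : ℕ} {n p j : Fin K → ℕ}
  {A : ∀ k, EuclideanSpace ℝ (Fin (n k)) →L[ℝ] EuclideanSpace ℝ (Fin (p k))}
  {E : ∀ k, EuclideanSpace ℝ (Fin (n k)) →L[ℝ] EuclideanSpace ℝ (Fin m)}
  {σ L : Fin K → ℝ}
  {g : ∀ k, EuclideanSpace ℝ (Fin (p k)) → EReal}
  {h : ∀ k, EuclideanSpace ℝ (Fin (n k)) → EReal}
  {X : ∀ k, Set (EuclideanSpace ℝ (Fin (n k)))}
  {Cx : ∀ k, EuclideanSpace ℝ (Fin (n k)) →L[ℝ] EuclideanSpace ℝ (Fin (j k))}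
  {Cs c : Vec j} {q : EuclideanSpace ℝ (Fin m)} {v : Point m n}

/-- A minimizer over a polyhedral set also minimizes the linearized objective there, so Farkas'
lemma yields multipliers. The case `M = 0` serves to lift saddle points of `Lbar`; the case `M = E`,
`d = 0` serves existence. -/
theorem exists_block_multipliers (hS : StructureAssumption A σ L g h X)
    (hR : Represents Cx Cs c h X) (d : Vec n) (M : Vec n →L[ℝ] EuclideanSpace ℝ (Fin m))
    {x : Vec n} {s : EuclideanSpace ℝ (Fin K)}
    (hs : ∀ k i, c k i ≤ (Cx k (x k) + s k • Cs k) i)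
    (hmin : ∀ (x' : Vec n) (s' : EuclideanSpace ℝ (Fin K)),
      (∀ k i, c k i ≤ (Cx k (x' k) + s' k • Cs k) i) → M x' = M x →
        smoothPart A g x + ⟪d, x⟫ + ∑ k, s k ≤ smoothPart A g x' + ⟪d, x'⟫ + ∑ k, s' k) :
    ∃ (lam : Vec j) (μ : EuclideanSpace ℝ (Fin m)), (∀ k i, 0 ≤ lam k i) ∧
      (∀ k, ⟪Cs k, lam k⟫ = 1) ∧ (∀ k, ⟪Cx k (x k) + s k • Cs k - c k, lam k⟫ = 0) ∧
      ∀ y : Vec n, ⟪gradMap A g x + d, y⟫ + ⟪M y, μ⟫ = ∑ k, ⟪Cx k (y k), lam k⟫ := by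
  classical
  let V := WithLp 2 (Vec n × EuclideanSpace ℝ (Fin K))
  let πx : V →L[ℝ] Vec n := WithLp.fstL 2 ℝ _ _
  let πs : V →L[ℝ] EuclideanSpace ℝ (Fin K) := WithLp.sndL 2 ℝ _ _
  let S1 : EuclideanSpace ℝ (Fin K) →L[ℝ] ℝ := ∑ k, EuclideanSpace.proj k
  have hS1 : ∀ s, S1 s = ∑ k, s k := fun s => by simp [S1]
  let C (k : Fin K) : V →L[ℝ] EuclideanSpace ℝ (Fin (j k)) :=
    (Cx k).comp ((PiLp.proj 2 (fun k => EuclideanSpace ℝ (Fin (n k))) k : Vec n →L[ℝ] _).comp πx)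
      + ((EuclideanSpace.proj k : EuclideanSpace ℝ (Fin K) →L[ℝ] ℝ).comp πs).smulRight (Cs k)
  let a : ((Σ k, Fin (j k)) ⊕ (Fin m ⊕ Fin m)) → V →L[ℝ] ℝ :=
    Sum.elim (fun i => (EuclideanSpace.proj i.2 : EuclideanSpace ℝ _ →L[ℝ] ℝ).comp (C i.1))
      (Sum.elim (fun i => (EuclideanSpace.proj i : EuclideanSpace ℝ _ →L[ℝ] ℝ).comp (M.comp πx))
        (fun i => -(EuclideanSpace.proj i : EuclideanSpace ℝ _ →L[ℝ] ℝ).comp (M.comp πx)))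
  let b : ((Σ k, Fin (j k)) ⊕ (Fin m ⊕ Fin m)) → ℝ :=
    Sum.elim (fun i => c i.1 i.2) (Sum.elim (fun i => M x i) (fun i => -(M x i)))
  let ℓ : V →L[ℝ] ℝ := (innerSL ℝ (gradMap A g x + d)).comp πx + S1.comp πs
  have hℓ : ∀ z : V, ℓ z = ⟪gradMap A g x + d, z.fst⟫ + ∑ k, z.snd k := fun z => by
    rw [← hS1]; rfl
  let z₀ : V := WithLp.toLp 2 (x, s)
  let feas : Set V := {z | ∀ i, b i ≤ a i z}
  have hfeas : ∀ z : V, z ∈ feas ↔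
      (∀ k i, c k i ≤ (Cx k (z.fst k) + z.snd k • Cs k) i) ∧ M z.fst = M x := by
    intro z
    constructor
    · intro hz
      refine ⟨fun k i => hz (Sum.inl ⟨k, i⟩), ?_⟩
      ext i
      exact le_antisymm (neg_le_neg_iff.1 (hz (Sum.inr (Sum.inr i)))) (hz (Sum.inr (Sum.inl i)))
    · rintro ⟨h1, h2⟩ (⟨k, i⟩ | i | i)
      · exact h1 k i
      · exact (congrFun (congrArg WithLp.ofLp h2) i).ge
      · exact neg_le_neg (congrFun (congrArg WithLp.ofLp h2) i).le
  have hz₀ : z₀ ∈ feas := (hfeas z₀).2 ⟨hs, rfl⟩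
  have hconv : Convex ℝ feas := by
    have : feas = ⋂ i, {z | b i ≤ a i z} := by ext; simp [feas]
    rw [this]
    exact convex_iInter fun i => convex_halfSpace_ge (a i).isLinear (b i)
  have hderiv : HasFDerivAt (fun z : V => smoothPart A g (πx z) + innerSL ℝ d (πx z) + S1 (πs z))
      ℓ z₀ := by
    have h1 : HasFDerivAt (fun z : V => smoothPart A g (πx z))
        ((innerSL ℝ (gradMap A g x)).comp πx) z₀ :=
      HasFDerivAt.comp z₀ (hS.hasFDerivAt_smoothPart (hR.mem_prodSet hs)) πx.hasFDerivAt
    have h2 := ((innerSL ℝ d).comp πx).hasFDerivAt (x := z₀)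
    have h3 := (S1.comp πs).hasFDerivAt (x := z₀)
    refine ((h1.add h2).add h3).congr_fderiv ?_
    simp only [ℓ, map_add, ContinuousLinearMap.add_comp]
  have hlocmin : IsLocalMinOn
      (fun z : V => smoothPart A g (πx z) + innerSL ℝ d (πx z) + S1 (πs z)) feas z₀ := by
    refine (isMinOn_iff.2 fun z hz => ?_).localize
    obtain ⟨h1, h2⟩ := (hfeas z).1 hz
    rw [hS1, hS1]
    exact hmin z.fst z.snd h1 h2
  obtain ⟨e, he, hcompl, hlin⟩ := exists_multipliers a b ℓ z₀ hz₀ fun z hz => by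
    have := hlocmin.hasFDerivWithinAt_nonneg hderiv.hasFDerivWithinAt
      (sub_mem_posTangentConeAt_of_segment_subset (hconv.segment_subset hz₀ hz))
    rw [map_sub] at this
    linarith
  refine ⟨WithLp.toLp 2 fun k => WithLp.toLp 2 fun i => e (Sum.inl ⟨k, i⟩),
    -- The equation for `M` was split into two opposite inequalities; the difference of their
    -- multipliers is free in sign and is oriented so that `μ` appears on the gradient side.
    WithLp.toLp 2 fun i => e (Sum.inr (Sum.inr i)) - e (Sum.inr (Sum.inl i)),
    fun k i => he _, ?_⟩
  have hlin' : ∀ (y : Vec n) (t : EuclideanSpace ℝ (Fin K)), ⟪gradMap A g x + d, y⟫ + ∑ k, t k =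
      ∑ k, ⟪Cx k (y k) + t k • Cs k,
        WithLp.toLp 2 fun i => e (Sum.inl ⟨k, i⟩)⟫ -
      ⟪M y, WithLp.toLp 2 fun i => e (Sum.inr (Sum.inr i)) - e (Sum.inr (Sum.inl i))⟫ := by
    intro y t
    refine (hℓ (WithLp.toLp 2 (y, t))).symm.trans ?_
    rw [hlin, Fintype.sum_sum_type, Fintype.sum_sum_type, Fintype.sum_sigma, sub_eq_add_neg]
    congr 1
    rw [PiLp.inner_apply, ← Finset.sum_neg_distrib, ← Finset.sum_add_distrib]
    refine Finset.sum_congr rfl fun i _ => ?_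
    change e (Sum.inr (Sum.inl i)) * (M y i) + e (Sum.inr (Sum.inr i)) * (-(M y i)) =
      -((e (Sum.inr (Sum.inr i)) - e (Sum.inr (Sum.inl i))) * (M y i))
    ring
  refine ⟨fun k => ?_, fun k => ?_, fun y => ?_⟩
  · have := hlin' 0 (EuclideanSpace.single k 1)
    simp only [inner_zero_right, PiLp.zero_apply, map_zero, inner_zero_left, zero_add,
      sub_zero] at this
    rw [Finset.sum_eq_single k, Finset.sum_eq_single k] at this
    · simpa using this.symm
    · intro k' _ hk'
      simp [hk']
    · simp
    · intro k' _ hk'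
      simp [hk']
    · simp
  · rw [PiLp.inner_apply]
    exact Finset.sum_eq_zero fun i _ => hcompl (Sum.inl ⟨k, i⟩)
  · have := hlin' y 0
    simp only [PiLp.zero_apply, zero_smul, add_zero, Finset.sum_const_zero] at this
    rw [this]
    ring

end Multipliers
/-! ### The Lagrangian of the decomposed problem -/

section Decomposed

variable {K m : ℕ} {n p j : Fin K → ℕ}
  {A : ∀ k, EuclideanSpace ℝ (Fin (n k)) →L[ℝ] EuclideanSpace ℝ (Fin (p k))}
  {E : ∀ k, EuclideanSpace ℝ (Fin (n k)) →L[ℝ] EuclideanSpace ℝ (Fin m)}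
  {σ L : Fin K → ℝ}
  {g : ∀ k, EuclideanSpace ℝ (Fin (p k)) → EReal}
  {h : ∀ k, EuclideanSpace ℝ (Fin (n k)) → EReal}
  {X : ∀ k, Set (EuclideanSpace ℝ (Fin (n k)))}
  {Cx : ∀ k, EuclideanSpace ℝ (Fin (n k)) →L[ℝ] EuclideanSpace ℝ (Fin (j k))}
  {Cs c : Vec j} {q : EuclideanSpace ℝ (Fin m)} {v : Point m n}

variable (h) in
/-- The vector with entries `h_k(x_k)`. -/
noncomputable def polyValues (x : Vec n) : EuclideanSpace ℝ (Fin K) :=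
  WithLp.toLp 2 fun k => (h k (x k)).toReal

theorem StructureAssumption.coe_polyValues (hS : StructureAssumption A σ L g h X) {x : Vec n}
    {k : Fin K} (hx : h k (x k) ≠ ⊤) : (polyValues h x k : EReal) = h k (x k) :=
  EReal.coe_toReal hx ((hS.h_cpc k).ne_bot _)

theorem Represents.slack_polyValues (hR : Represents Cx Cs c h X)
    (hS : StructureAssumption A σ L g h X) {x : Vec n} (hx : x ∈ prodSet X)
    (hfin : ∀ k, h k (x k) ≠ ⊤) (k : Fin K) (i : Fin (j k)) :
    c k i ≤ (Cx k (x k) + polyValues h x k • Cs k) i :=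
  (hR k _ _).1 ⟨hx k, (hS.coe_polyValues (hfin k)).ge⟩ i

theorem Represents.finite_h (hR : Represents Cx Cs c h X) {x : Vec n}
    {s : EuclideanSpace ℝ (Fin K)} (hs : ∀ k i, c k i ≤ (Cx k (x k) + s k • Cs k) i)
    (k : Fin K) : h k (x k) ≠ ⊤ :=
  (((hR k _ _).2 (hs k)).2.trans_lt (EReal.coe_lt_top _)).ne

theorem Represents.polyValues_le (hR : Represents Cx Cs c h X)
    (hS : StructureAssumption A σ L g h X) {x : Vec n}
    {s : EuclideanSpace ℝ (Fin K)} (hs : ∀ k i, c k i ≤ (Cx k (x k) + s k • Cs k) i)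
    (k : Fin K) : polyValues h x k ≤ s k := by
  rw [← EReal.coe_le_coe_iff, hS.coe_polyValues (hR.finite_h hs k)]
  exact ((hR k _ _).2 (hs k)).2

theorem StructureAssumption.blockObj_eq_coe (hS : StructureAssumption A σ L g h X) {x : Vec n}
    (hx : x ∈ prodSet X) {k : Fin K} (hfin : h k (x k) ≠ ⊤) :
    blockObj A g h k (x k) =
      (((g k (A k (x k))).toReal + polyValues h x k : ℝ) : EReal) := by
  rw [EReal.coe_add, hS.coe_polyValues hfin,
    EReal.coe_toReal (hS.finite_g hx k) ((hS.g_cpc k).ne_bot _)]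
  rfl

theorem StructureAssumption.blockObj_ne_bot (hS : StructureAssumption A σ L g h X) (k : Fin K)
    (x : EuclideanSpace ℝ (Fin (n k))) : blockObj A g h k x ≠ ⊥ :=
  EReal.add_ne_bot_iff.2 ⟨(hS.g_cpc k).ne_bot _, (hS.h_cpc k).ne_bot _⟩

theorem StructureAssumption.blockObj_eq_top (hS : StructureAssumption A σ L g h X) {k : Fin K}
    {x : EuclideanSpace ℝ (Fin (n k))} (hx : h k x = ⊤) : blockObj A g h k x = ⊤ := by
  unfold blockObj
  rw [hx]
  exact EReal.add_top_of_ne_bot ((hS.g_cpc k).ne_bot _)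

theorem StructureAssumption.totalObj_eq_coe (hS : StructureAssumption A σ L g h X) {x : Vec n}
    (hx : x ∈ prodSet X) (hfin : ∀ k, h k (x k) ≠ ⊤) :
    totalObj (blockObj A g h) x =
      ((smoothPart A g x + ∑ k, polyValues h x k : ℝ) : EReal) := by
  unfold totalObj smoothPart
  rw [← Finset.sum_add_distrib, ereal_coe_sum]
  exact Finset.sum_congr rfl fun k _ => hS.blockObj_eq_coe hx (hfin k)

theorem StructureAssumption.finite_h_of_totalObj (hS : StructureAssumption A σ L g h X)
    {x : Vec n} (hx : totalObj (blockObj A g h) x < ⊤) (k : Fin K) : h k (x k) ≠ ⊤ := by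
  intro htop
  refine hx.ne ?_
  exact ereal_sum_eq_top _ (fun k => hS.blockObj_ne_bot k _) (Finset.mem_univ k)
    (hS.blockObj_eq_top htop)

/-- Either qualification provides such a point, which excludes the case that the attained minimum is
`⊤`. -/
theorem SaddleAssumption.exists_finite (hA : SaddleAssumption E q (blockObj A g h) X)
    (hS : StructureAssumption A σ L g h X) :
    ∃ x ∈ prodSet X ∩ linConstr E q, ∀ k, h k (x k) ≠ ⊤ := by
  rcases hA.qualification with ⟨x, ⟨hx, hd⟩, hq⟩ | ⟨-, x, ⟨hx, hd⟩, hq⟩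
  · exact ⟨x, ⟨interior_subset hx, hq⟩, hS.finite_h_of_totalObj hd⟩
  · have hd' : x ∈ effDom (totalObj (blockObj A g h)) := interior_subset hd
    exact ⟨x, ⟨hx, hq⟩, hS.finite_h_of_totalObj hd'⟩

theorem inner_projWperp (η ζ : Blocks K m) : ⟪projWperp η, ζ⟫ = ⟪η, projWperp ζ⟫ :=
  Submodule.inner_starProjection_left_eq_right _ _ _

/-- On `S` one has `ζ = P η`, and `P` is self-adjoint, so the tilt by `v₄` acts on `η` as `P v₄`.
This is how `v₄` reaches the linking constraint of the canonical problem. -/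
theorem StructureAssumption.LbarTilted_eq_coe (hS : StructureAssumption A σ L g h X)
    {w : Blocks K m} {x : Vec n} {η ζ : Blocks K m} (hw : w ∈ W K m) (hx : x ∈ prodSet X)
    (hζ : (η, ζ) ∈ S K m) (hfin : ∀ k, h k (x k) ≠ ⊤) :
    LbarTilted E q (blockObj A g h) X v w x η ζ =
      ((smoothPart A g x + linPart E Cx Cs c q v w x (polyValues h x) η 0 0 : ℝ) : EReal) := by
  unfold LbarTilted Lbar
  rw [if_pos ⟨hw, hx⟩, if_pos hζ]
  have hterm : ∀ k, blockLagrangian E q (blockObj A g h) k (x k) (η k) -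
      ((⟪η k, w k⟫ : ℝ) : EReal) = (((g k (A k (x k))).toReal + polyValues h x k +
        ⟪η k, E k (x k) - rhs q k⟫ - ⟪η k, w k⟫ : ℝ) : EReal) := by
    intro k
    unfold blockLagrangian
    rw [hS.blockObj_eq_coe hx (hfin k), ← EReal.coe_add, ← EReal.coe_sub]
  simp only [hterm]
  rw [← ereal_coe_sum, ← EReal.coe_add]
  congr 1
  have hζ' : ζ = projWperp η := (Eq.symm hζ : _)
  rw [hζ', inner_projWperp, linPart]
  simp only [Finset.sum_add_distrib, Finset.sum_sub_distrib, PiLp.zero_apply, inner_zero_right,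
    Finset.sum_const_zero, inner_add_left, inner_sub_left, smoothPart, inner_sub_right,
    PiLp.inner_apply (x := η)]
  simp only [real_inner_comm (η _)]
  ring

theorem StructureAssumption.LbarTilted_eq_top (hS : StructureAssumption A σ L g h X)
    {w : Blocks K m} {x : Vec n} {η ζ : Blocks K m} (hw : w ∈ W K m) (hx : x ∈ prodSet X)
    (hζ : (η, ζ) ∈ S K m) {k : Fin K} (hk : h k (x k) = ⊤) :
    LbarTilted E q (blockObj A g h) X v w x η ζ = ⊤ := by
  unfold LbarTilted Lbar
  rw [if_pos ⟨hw, hx⟩, if_pos hζ]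
  refine (congrArg (· + _) (ereal_sum_eq_top _ (fun k => ?_) (Finset.mem_univ k) ?_)).trans
    (EReal.top_add_coe _)
  · rw [sub_eq_add_neg, ← EReal.coe_neg]
    exact EReal.add_ne_bot_iff.2 ⟨EReal.add_ne_bot_iff.2 ⟨hS.blockObj_ne_bot k _,
      EReal.coe_ne_bot _⟩, EReal.coe_ne_bot _⟩
  · unfold blockLagrangian
    rw [hS.blockObj_eq_top hk, EReal.top_add_coe]
    exact EReal.top_sub_coe _

theorem sum_rhs (hK : 0 < K) (q : EuclideanSpace ℝ (Fin m)) : ∑ k : Fin K, rhs q k = q := by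
  rw [Finset.sum_eq_single (⟨K - 1, by omega⟩ : Fin K)]
  · simp only [rhs]
    rw [if_pos (by omega)]
  · intro k _ hk
    refine if_neg fun h1 => hk (Fin.ext ?_)
    simp only
    omega
  · simp

/-- A saddle point of the decomposed Lagrangian extends to a Karush-Kuhn-Tucker point. -/
theorem exists_kkt_of_mem_TLbarInv (hK : 0 < K) (hS : StructureAssumption A σ L g h X)
    (hR : Represents Cx Cs c h X) (hA : SaddleAssumption E q (blockObj A g h) X)
    {u : Point m n} (hu : u ∈ TLbarInv E q (blockObj A g h) X v) :
    ∃ z : KKTPoint m n j, KKT A E g Cx Cs c q v z ∧ z.fst.fst = u.fst.fst ∧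
      z.fst.snd.fst = u.fst.snd ∧ z.snd.fst = u.snd.fst ∧ projWperp z.snd.fst = u.snd.snd := by
  obtain ⟨hw, hx, hζ, hmin, hmax⟩ := hu
  obtain ⟨x₁, ⟨hx₁, -⟩, hx₁fin⟩ := hA.exists_finite hS
  set w := u.fst.fst
  set x := u.fst.snd
  set η := u.snd.fst
  set ζ := u.snd.snd
  have hfin : ∀ k, h k (x k) ≠ ⊤ := by
    intro k hk
    have := hmin w hw x₁ hx₁
    rw [hS.LbarTilted_eq_top hw hx hζ hk,
      hS.LbarTilted_eq_coe (Cx := Cx) (Cs := Cs) (c := c) hw hx₁ hζ hx₁fin, top_le_iff] at this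
    exact EReal.coe_ne_top _ this
  have hmin' : ∀ w' ∈ W K m, ∀ x' ∈ prodSet X, (∀ k, h k (x' k) ≠ ⊤) →
      smoothPart A g x + linPart E Cx Cs c q v w x (polyValues h x) η 0 0 ≤
        smoothPart A g x' + linPart E Cx Cs c q v w' x' (polyValues h x') η 0 0 := by
    intro w' hw' x' hx' hfin'
    have := hmin w' hw' x' hx'
    rwa [hS.LbarTilted_eq_coe (Cx := Cx) (Cs := Cs) (c := c) hw hx hζ hfin,
      hS.LbarTilted_eq_coe (Cx := Cx) (Cs := Cs) (c := c) hw' hx' hζ hfin',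
      EReal.coe_le_coe_iff] at this
  have hmax' : ∀ η' : Blocks K m,
      linPart E Cx Cs c q v w x (polyValues h x) η' 0 0 ≤
        linPart E Cx Cs c q v w x (polyValues h x) η 0 0 := by
    intro η'
    have hη' : (η', projWperp η') ∈ S K m := rfl
    have := hmax η' (projWperp η') hη'
    rw [hS.LbarTilted_eq_coe (Cx := Cx) (Cs := Cs) (c := c) hw hx hζ hfin,
      hS.LbarTilted_eq_coe (Cx := Cx) (Cs := Cs) (c := c) hw hx hη' hfin,
      EReal.coe_le_coe_iff] at this
    linarith
  have hlink : ∀ k, E k (x k) - w k + shift q v k = 0 := by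
    obtain ⟨R, hRk⟩ : ∃ R : Blocks K m, ∀ k, E k (x k) - w k + shift q v k = R k :=
      ⟨WithLp.toLp 2 fun k => E k (x k) - w k + shift q v k, fun _ => rfl⟩
    simp only [hRk]
    refine eq_zero_of_sum_norm_sq_le ?_
    have := hmax' (η + R)
    rw [linPart_eq_dual, linPart_eq_dual] at this
    simp only [hRk, PiLp.add_apply, inner_add_right, Finset.sum_add_distrib,
      real_inner_self_eq_norm_sq] at this
    linarith
  obtain ⟨μ, hμ⟩ : ∃ μ : EuclideanSpace ℝ (Fin m), ∀ k, μ - η k - v.fst.fst k = 0 := by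
    -- Minimality holds only along `W`, so `η + v₁` is orthogonal to `W`, that is, has equal blocks;
    -- the common block is their average.
    refine ⟨(K : ℝ)⁻¹ • ∑ k, (η k + v.fst.fst k), ?_⟩
    set μ := (K : ℝ)⁻¹ • ∑ k, (η k + v.fst.fst k)
    obtain ⟨D, hD⟩ : ∃ D : Blocks K m, ∀ k, μ - η k - v.fst.fst k = D k :=
      ⟨WithLp.toLp 2 fun k => μ - η k - v.fst.fst k, fun _ => rfl⟩
    have hDsum : ∑ k, D k = 0 := by
      have hK' : (K : ℝ) ≠ 0 := by exact_mod_cast hK.ne'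
      simp only [← hD, sub_sub]
      rw [Finset.sum_sub_distrib, Finset.sum_const, Finset.card_univ, Fintype.card_fin,
        ← Nat.cast_smul_eq_nsmul ℝ, smul_inv_smul₀ hK', sub_self]
    simp only [hD]
    refine eq_zero_of_sum_norm_sq_le ?_
    have := hmin' (w - D) (Submodule.sub_mem _ hw hDsum) x hx hfin
    rw [linPart_eq_primal, linPart_eq_primal] at this
    have e : ∀ k, 0 - η k - v.fst.fst k = D k - μ := fun k => by rw [← hD]; abel
    simp only [e, PiLp.sub_apply, inner_sub_left (𝕜 := ℝ) (w _), Finset.sum_add_distrib,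
      Finset.sum_sub_distrib] at this
    have e2 : ∑ k, ⟪D k, D k - μ⟫ = ∑ k, ‖D k‖ ^ 2 := by
      simp only [inner_sub_right, Finset.sum_sub_distrib, real_inner_self_eq_norm_sq]
      rw [← sum_inner, hDsum, inner_zero_left, sub_zero]
    linarith
  obtain ⟨d, hd⟩ : ∃ d : Vec n, ∀ k, (E k).adjoint (η k) - v.fst.snd k = d k :=
    ⟨WithLp.toLp 2 fun k => (E k).adjoint (η k) - v.fst.snd k, fun _ => rfl⟩
  -- With `w` fixed, `x` minimizes over `X` without linking constraint, hence `M = 0`. The epigraph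
  -- variable is set to `h_k(x_k)`, its least admissible value.
  obtain ⟨lam, μ₀, hlam, hds, hcompl, hlin⟩ := exists_block_multipliers (m := m) hS hR d 0
    (hR.slack_polyValues hS hx hfin) fun x' s' hs' _ => by
      have := hmin' w hw x' (hR.mem_prodSet hs') (hR.finite_h hs')
      rw [linPart_eq_primal, linPart_eq_primal] at this
      simp only [hd, PiLp.zero_apply, map_zero, inner_zero_right, sub_zero, mul_one,
        Finset.sum_add_distrib] at this
      have h1 : ∑ k, polyValues h x' k ≤ ∑ k, s' k :=
        Finset.sum_le_sum fun k _ => hR.polyValues_le hS hs' k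
      rw [real_inner_comm, real_inner_comm x', PiLp.inner_apply, PiLp.inner_apply]
      linarith
  refine ⟨WithLp.toLp 2 (WithLp.toLp 2 (w, WithLp.toLp 2 (x, polyValues h x)),
    WithLp.toLp 2 (η, WithLp.toLp 2 (lam, μ))), ⟨fun k => ?_, ?_, hds, hlink, hw,
      hR.slack_polyValues hS hx hfin, hlam, hcompl⟩, rfl, rfl, rfl, hζ⟩
  · change η k - μ + v.fst.fst k = 0
    rw [← neg_eq_zero, ← hμ k]
    abel
  · change ∀ k, (E k).adjoint (η k) - (Cx k).adjoint (lam k) +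
      (gradMap A g x - v.fst.snd) k = 0
    obtain ⟨R, hRk⟩ : ∃ R : Vec n, ∀ k, (E k).adjoint (η k) - (Cx k).adjoint (lam k) +
      (gradMap A g x - v.fst.snd) k = R k := ⟨WithLp.toLp 2 fun k => _, fun _ => rfl⟩
    simp only [hRk]
    refine eq_zero_of_sum_norm_sq_le ?_
    have := hlin R
    rw [zero_apply, inner_zero_left, add_zero, PiLp.inner_apply] at this
    rw [← sub_eq_zero, ← Finset.sum_sub_distrib] at this
    rw [← this]
    refine le_of_eq (Finset.sum_congr rfl fun k _ => ?_)
    rw [← real_inner_self_eq_norm_sq, ← ContinuousLinearMap.adjoint_inner_right,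
      real_inner_comm ((Cx k).adjoint (lam k)), ← inner_sub_left]
    congr 1
    rw [← hRk, PiLp.add_apply, ← hd, PiLp.sub_apply]
    abel

/-- The multiplier `μ` of `E x = q` is used for every block of `η`, and `w_k = E_k x_k - q_k` sums
to zero by feasibility. -/
theorem nonempty_kkt_zero (hK : 0 < K) (hS : StructureAssumption A σ L g h X)
    (hR : Represents Cx Cs c h X) (hA : SaddleAssumption E q (blockObj A g h) X) :
    ∃ z : KKTPoint m n j, KKT A E g Cx Cs c q 0 z := by
  obtain ⟨x₁, hx₁, hx₁fin⟩ := hA.exists_finite hS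
  obtain ⟨x, ⟨hx, hxq⟩, hmin⟩ := hA.attained
  have hfin : ∀ k, h k (x k) ≠ ⊤ := by
    refine hS.finite_h_of_totalObj ((hmin x₁ hx₁).trans_lt ?_)
    rw [hS.totalObj_eq_coe hx₁.1 hx₁fin]
    exact EReal.coe_lt_top _
  let M : Vec n →L[ℝ] EuclideanSpace ℝ (Fin m) :=
    ∑ k, (E k).comp (PiLp.proj 2 (fun k => EuclideanSpace ℝ (Fin (n k))) k)
  have hM : ∀ y, M y = ∑ k, E k (y k) := by
    intro y
    rw [sum_apply]
    rfl
  have hxM : M x = q := (hM x).trans hxq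
  obtain ⟨lam, μ, hlam, hds, hcompl, hlin⟩ := exists_block_multipliers hS hR 0 M
    (hR.slack_polyValues hS hx hfin) fun x' s' hs' hM' => by
      have := hmin x' ⟨hR.mem_prodSet hs', (hM x').symm.trans (hM'.trans hxM)⟩
      rw [hS.totalObj_eq_coe hx hfin, hS.totalObj_eq_coe (hR.mem_prodSet hs') (hR.finite_h hs'),
        EReal.coe_le_coe_iff] at this
      have h1 : ∑ k, polyValues h x' k ≤ ∑ k, s' k :=
        Finset.sum_le_sum fun k _ => hR.polyValues_le hS hs' k
      rw [inner_zero_left, inner_zero_left]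
      linarith
  refine ⟨WithLp.toLp 2 (WithLp.toLp 2 (WithLp.toLp 2 fun k => E k (x k) - rhs q k,
    WithLp.toLp 2 (x, polyValues h x)),
    WithLp.toLp 2 (WithLp.toLp 2 fun _ => μ, WithLp.toLp 2 (lam, μ))), ⟨fun k => ?_, ?_, hds,
      fun k => ?_, ?_, hR.slack_polyValues hS hx hfin, hlam, hcompl⟩⟩
  · change μ - μ + 0 = 0
    simp
  · change ∀ k, (E k).adjoint μ - (Cx k).adjoint (lam k) + (gradMap A g x - 0) k = 0
    obtain ⟨R, hRk⟩ : ∃ R : Vec n, ∀ k, (E k).adjoint μ - (Cx k).adjoint (lam k) +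
      (gradMap A g x - 0) k = R k := ⟨WithLp.toLp 2 fun k => _, fun _ => rfl⟩
    simp only [hRk]
    refine eq_zero_of_sum_norm_sq_le ?_
    have := hlin R
    rw [hM, sum_inner, PiLp.inner_apply, ← sub_eq_zero, ← Finset.sum_add_distrib,
      ← Finset.sum_sub_distrib] at this
    rw [← this]
    refine le_of_eq (Finset.sum_congr rfl fun k _ => ?_)
    rw [← real_inner_self_eq_norm_sq, ← ContinuousLinearMap.adjoint_inner_right,
      ← ContinuousLinearMap.adjoint_inner_right,
      real_inner_comm ((Cx k).adjoint (lam k)), real_inner_comm ((E k).adjoint μ),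
      ← inner_add_left, ← inner_sub_left]
    congr 1
    rw [← hRk, PiLp.add_apply, PiLp.sub_apply, PiLp.zero_apply]
    abel
  · change E k (x k) - (E k (x k) - rhs q k) + shift q (0 : Point m n) k = 0
    rw [shift_zero]
    abel
  · change ∑ k, (E k (x k) - rhs q k) = 0
    rw [Finset.sum_sub_distrib, sum_rhs hK, ← hM, hxM, sub_self]

/-- The point of the decomposed problem given by a point of the canonical problem. -/
noncomputable def toPoint (z : KKTPoint m n j) : Point m n :=
  WithLp.toLp 2 (WithLp.toLp 2 (z.fst.fst, z.fst.snd.fst),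
    WithLp.toLp 2 (z.snd.fst, projWperp z.snd.fst))

theorem KKT.toPoint_mem_TLbarInv {z : KKTPoint m n j} (hz : KKT A E g Cx Cs c q 0 z)
    (hS : StructureAssumption A σ L g h X) (hσ : ∀ k, 0 < σ k) (hR : Represents Cx Cs c h X) :
    toPoint z ∈ TLbarInv E q (blockObj A g h) X 0 := by
  have hg : ∀ k y, g k y ≠ ⊥ := fun k => (hS.g_cpc k).ne_bot
  have hx := hz.mem_prodSet hR
  have hfin := hR.finite_h hz.slack
  have hw : z.fst.fst ∈ W K m := hz.sum_w
  have hζ : (z.snd.fst, projWperp z.snd.fst) ∈ S K m := rfl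
  refine ⟨hw, hx, hζ, fun w' hw' x' hx' => ?_, fun η' ζ' hζ' => ?_⟩
  · change LbarTilted E q (blockObj A g h) X 0 z.fst.fst z.fst.snd.fst z.snd.fst
      (projWperp z.snd.fst) ≤ LbarTilted E q (blockObj A g h) X 0 w' x' z.snd.fst
      (projWperp z.snd.fst)
    by_cases hfin' : ∀ k, h k (x' k) ≠ ⊤
    · rw [hS.LbarTilted_eq_coe (Cx := Cx) (Cs := Cs) (c := c) hw hx hζ hfin,
        hS.LbarTilted_eq_coe (Cx := Cx) (Cs := Cs) (c := c) hw' hx' hζ hfin',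
        EReal.coe_le_coe_iff]
      -- Comparison at `s' = h(x')` eliminates `s`: the slack pairing there is nonnegative, and
      -- `h_k(x_k) ≤ s_k` at `z`.
      have h1 := (hz.mem_Sol hS hσ hR).2.1 w' x' (polyValues h x')
      rw [canonLagrangian_eq_coe _ _ _ _ _ _ _ _ _ _ _ _ hg (hS.finite_g hx),
        canonLagrangian_eq_coe _ _ _ _ _ _ _ _ _ _ _ _ hg (hS.finite_g hx'),
        EReal.coe_le_coe_iff, linPart_eq_dual, linPart_eq_dual, hz.sum_w] at h1
      rw [linPart_eq_dual, linPart_eq_dual]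
      have hw'' : ∑ k, w' k = 0 := hw'
      have h2 : ∑ k, polyValues h z.fst.snd.fst k ≤ ∑ k, z.fst.snd.snd k :=
        Finset.sum_le_sum fun k _ => hR.polyValues_le hS hz.slack k
      have h3 : 0 ≤ ∑ k, ⟪Cx k (x' k) + polyValues h x' k • Cs k - c k, z.snd.snd.fst k⟫ :=
        Finset.sum_nonneg fun k _ => inner_nonneg_of_nonneg
          (fun i => sub_nonneg.2 (hR.slack_polyValues hS hx' hfin' k i)) (hz.nonneg k)
      simp only [hz.compl, hw'', inner_zero_left, inner_zero_right, PiLp.zero_apply,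
        Finset.sum_const_zero] at h1 ⊢
      linarith
    · push Not at hfin'
      obtain ⟨k, hk⟩ := hfin'
      rw [hS.LbarTilted_eq_top hw' hx' hζ hk]
      exact le_top
  · change LbarTilted E q (blockObj A g h) X 0 z.fst.fst z.fst.snd.fst η' ζ' ≤
      LbarTilted E q (blockObj A g h) X 0 z.fst.fst z.fst.snd.fst z.snd.fst
      (projWperp z.snd.fst)
    rw [hS.LbarTilted_eq_coe (Cx := Cx) (Cs := Cs) (c := c) hw hx hζ hfin,
      hS.LbarTilted_eq_coe (Cx := Cx) (Cs := Cs) (c := c) hw hx hζ' hfin,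
      EReal.coe_le_coe_iff, linPart_eq_dual, linPart_eq_dual]
    simp only [hz.link, inner_zero_left, le_refl]

/-- The additional `ζ` component is a nonexpansive image of `η`, so the squared norm at most
doubles. -/
theorem norm_toPoint_sub_le (u : Point m n) (z z' : KKTPoint m n j) (hw : z.fst.fst = u.fst.fst)
    (hx : z.fst.snd.fst = u.fst.snd) (hη : z.snd.fst = u.snd.fst)
    (hζ : projWperp z.snd.fst = u.snd.snd) : ‖u - toPoint z'‖ ≤ 2 * ‖z - z'‖ := by
  refine le_of_sq_le_sq ?_ (by positivity)
  have e : ‖u - toPoint z'‖ ^ 2 = ‖z.fst.fst - z'.fst.fst‖ ^ 2 +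
      ‖z.fst.snd.fst - z'.fst.snd.fst‖ ^ 2 + (‖z.snd.fst - z'.snd.fst‖ ^ 2 +
        ‖projWperp z.snd.fst - projWperp z'.snd.fst‖ ^ 2) := by
    rw [WithLp.prod_norm_sq_eq_of_L2, WithLp.prod_norm_sq_eq_of_L2,
      WithLp.prod_norm_sq_eq_of_L2, hw, hx, hζ, hη]
    rfl
  have e2 : ‖z - z'‖ ^ 2 = ‖z.fst.fst - z'.fst.fst‖ ^ 2 +
      (‖z.fst.snd.fst - z'.fst.snd.fst‖ ^ 2 + ‖z.fst.snd.snd - z'.fst.snd.snd‖ ^ 2) +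
      (‖z.snd.fst - z'.snd.fst‖ ^ 2 + ‖z.snd.snd - z'.snd.snd‖ ^ 2) := by
    rw [WithLp.prod_norm_sq_eq_of_L2, WithLp.prod_norm_sq_eq_of_L2,
      WithLp.prod_norm_sq_eq_of_L2, WithLp.prod_norm_sq_eq_of_L2]
    rfl
  have e3 : ‖projWperp z.snd.fst - projWperp z'.snd.fst‖ ^ 2 ≤
      ‖z.snd.fst - z'.snd.fst‖ ^ 2 := by
    have : projWperp z.snd.fst - projWperp z'.snd.fst = projWperp (z.snd.fst - z'.snd.fst) :=
      (map_sub _ _ _).symm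
    rw [this]
    gcongr
    exact Submodule.norm_starProjection_apply_le _ _
  rw [mul_pow, e, e2]
  have := sq_nonneg ‖z.fst.fst - z'.fst.fst‖
  have := sq_nonneg ‖z.fst.snd.fst - z'.fst.snd.fst‖
  have := sq_nonneg ‖z.fst.snd.snd - z'.fst.snd.snd‖
  have := sq_nonneg ‖z.snd.fst - z'.snd.fst‖
  have := sq_nonneg ‖z.snd.snd - z'.snd.snd‖
  linarith

/-- Polyhedral blocks have a representation by linear inequalities. -/
theorem StructureAssumption.exists_represents (hS : StructureAssumption A σ L g h X) :
    ∃ (j : Fin K → ℕ)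
      (Cx : ∀ k, EuclideanSpace ℝ (Fin (n k)) →L[ℝ] EuclideanSpace ℝ (Fin (j k)))
      (Cs c : Vec j), Represents Cx Cs c h X := by
  have hpoly : ∀ k, IsPolyhedral
      {y : EuclideanSpace ℝ (Fin (n k)) × ℝ | y.1 ∈ X k ∧ h k y.1 ≤ (y.2 : EReal)} := fun k =>
    ((hS.X_polyhedral k).preimage (ContinuousLinearMap.fst ℝ _ ℝ)).inter (hS.h_polyhedral k)
  choose N a b hab using hpoly
  refine ⟨N, fun k => ((EuclideanSpace.equiv (Fin (N k)) ℝ).symm :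
      (Fin (N k) → ℝ) →L[ℝ] EuclideanSpace ℝ (Fin (N k))).comp
        (ContinuousLinearMap.pi fun i => (a k i).comp (ContinuousLinearMap.inl ℝ _ ℝ)),
    WithLp.toLp 2 fun k => WithLp.toLp 2 fun i => a k i (0, 1),
    WithLp.toLp 2 fun k => WithLp.toLp 2 fun i => b k i, fun k x s => ?_⟩
  have h1 := Set.ext_iff.1 (hab k) (x, s)
  refine h1.trans (forall_congr' fun i => ?_)
  have h2 : ((x, s) : EuclideanSpace ℝ (Fin (n k)) × ℝ) = (x, 0) + s • (0, 1) := by simp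
  rw [h2, map_add, map_smul]
  rfl

end Decomposed
end ADA

/-! ### Assembly of the two error bounds. -/

theorem mainTheorem4 {K m : ℕ} (hK : 0 < K) {n p : Fin K → ℕ}
    (A : ∀ k, EuclideanSpace ℝ (Fin (n k)) →L[ℝ] EuclideanSpace ℝ (Fin (p k)))
    (E : ∀ k, EuclideanSpace ℝ (Fin (n k)) →L[ℝ] EuclideanSpace ℝ (Fin m))
    (σ L : Fin K → ℝ) (hσ : ∀ k, 0 < σ k) (hL : ∀ k, 0 ≤ L k) :
    (∀ (g : ∀ k, EuclideanSpace ℝ (Fin (p k)) → EReal)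
        (h : ∀ k, EuclideanSpace ℝ (Fin (n k)) → EReal)
        (X : ∀ k, Set (EuclideanSpace ℝ (Fin (n k)))),
      ADA.StructureAssumption A σ L g h X →
        ∃ (j : Fin K → ℕ)
          (Cx : ∀ k, EuclideanSpace ℝ (Fin (n k)) →L[ℝ] EuclideanSpace ℝ (Fin (j k)))
          (Cs c : ADA.Vec j), ADA.Represents Cx Cs c h X) ∧
    ∀ (j : Fin K → ℕ)
      (Cx : ∀ k, EuclideanSpace ℝ (Fin (n k)) →L[ℝ] EuclideanSpace ℝ (Fin (j k)))
      (Cs : ADA.Vec j),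
      ∃ τ : ℝ, 0 < τ ∧
        ∀ (q : EuclideanSpace ℝ (Fin m))
          (g : ∀ k, EuclideanSpace ℝ (Fin (p k)) → EReal)
          (h : ∀ k, EuclideanSpace ℝ (Fin (n k)) → EReal)
          (X : ∀ k, Set (EuclideanSpace ℝ (Fin (n k)))) (c : ADA.Vec j),
          ADA.SaddleAssumption E q (ADA.blockObj A g h) X →
          ADA.StructureAssumption A σ L g h X →
          ADA.Represents Cx Cs c h X →
            (ADA.Sol A E Cx Cs c q g 0).Nonempty ∧
            (ADA.TLbarInv E q (ADA.blockObj A g h) X 0).Nonempty ∧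
            ∃ δ : ℝ, 0 < δ ∧ ∀ v : ADA.Point m n, ‖v‖ ≤ δ →
              (∀ z ∈ ADA.Sol A E Cx Cs c q g v,
                Metric.infDist z (ADA.Sol A E Cx Cs c q g 0) ≤ τ * ‖v‖) ∧
              (∀ u ∈ ADA.TLbarInv E q (ADA.blockObj A g h) X v,
                Metric.infDist u (ADA.TLbarInv E q (ADA.blockObj A g h) X 0) ≤
                  2 * τ * ‖v‖) := by
  refine ⟨fun g h X hS => hS.exists_represents, fun j Cx Cs => ?_⟩
  obtain ⟨τ, hτ, hbound⟩ := ADA.exists_error_bound_Sol (m := m) A E Cx Cs hK hσ hL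
  refine ⟨τ, hτ, fun q g h X c hA hS hR => ?_⟩
  obtain ⟨z₀, hz₀⟩ := ADA.nonempty_kkt_zero hK hS hR hA
  have hne : (ADA.prodSet X).Nonempty := ⟨_, hz₀.mem_prodSet hR⟩
  have hSol : (ADA.Sol A E Cx Cs c q g 0).Nonempty := ⟨z₀, hz₀.mem_Sol hS hσ hR⟩
  obtain ⟨δ, hδ, hδ'⟩ := hbound q g h X c hS hR hne hSol
  refine ⟨hSol, ⟨_, hz₀.toPoint_mem_TLbarInv hS hσ hR⟩, δ, hδ, fun v hv => ⟨fun z hz => ?_,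
    fun u hu => ?_⟩⟩
  · obtain ⟨z', hz', hzz'⟩ := hδ' v hv z hz
    exact (Metric.infDist_le_dist_of_mem hz').trans ((dist_eq_norm z z').le.trans hzz')
  -- The point `u` is lifted to a KKT point, moved to an unperturbed one at cost `τ ‖v‖`, and
  -- projected back at the cost of a factor `2`.
  · obtain ⟨z, hz, hw, hx, hη, hζ⟩ := ADA.exists_kkt_of_mem_TLbarInv hK hS hR hA hu
    obtain ⟨z', hz', hzz'⟩ := hδ' v hv z (hz.mem_Sol hS hσ hR)
    have hmem := (ADA.Sol.kkt hz' hS hR hne).toPoint_mem_TLbarInv hS hσ hR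
    refine (Metric.infDist_le_dist_of_mem hmem).trans ?_
    rw [dist_eq_norm, mul_assoc]
    exact (ADA.norm_toPoint_sub_le u z z' hw hx hη hζ).trans (by gcongr)
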